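/- Let $\mathfrak g$ be a finite-dimensional simple complex Lie algebra with Cartan subalgebra $\mathfrak h$, a set of simple roots $\{\alpha_i\}_{i\in I}$, positive roots $R^+$, coroots $h_\alpha$, $h_i=h_{\alpha_i}$, and a Chevalley basis $\{x_\alpha^{\pm},h_i\}$, with $[x_\alpha^+,x_\alpha^-]=h_\alpha$ for $\alpha\in R^+$. Let $\mathfrak n^+=\bigoplus_{\alpha\in R^+}\mathbb C x_\alpha^+$. Let $n\ge 1$, let $\mathbb C[n]=\mathbb C[t_1,\dots,t_n]$, $\mathbb C\langle n\rangle=\mathbb C[t_1^{\pm1},\dots,t_n^{\pm1}]$, and write $\mathfrak a[n]=\mathfrak a\otimes\mathbb C[n]$, $\mathfrak a\langle n\rangle=\mathfrak a\otimes\mathbb C\langle n\rangle$; put $\mathfrak h[n]_0=\mathfrak h\otimes\{f\in\mathbb C[n]: f(0)=0\}$. Write $u^{(k)}=u^k/k!$. Let $U_{\mathbb Z}(\mathfrak g[n])\subset U(\mathfrak g[n])$ and $U_{\mathbb Z}(\mathfrak g\langle n\rangle)\subset U(\mathfrak g\langle n\rangle)$ be the subrings generated by the divided powers $(x_\alpha^\pm\otimes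 t^m)^{(k)}$, with $\alpha\in R^+$, $k\ge 0$, and $m\in\mathbb Z_{\ge0}^n$, respectively $m\in\mathbb Z^n$. For a Lie subalgebra $\mathfrak a$ of $\mathfrak g[n]$ or $\mathfrak g\langle n\rangle$ let $U_{\mathbb Z}(\mathfrak a)$ be the intersection of $U(\mathfrak a)$ with the respective ring. For a field $\mathbb F$ let $U_{\mathbb F}(\mathfrak a)=\mathbb F\otimes_{\mathbb Z}U_{\mathbb Z}(\mathfrak a)$, and let $U_{\mathbb F}(\mathfrak a)^0$ be its augmentation ideal, spanned by the $1\otimes u$ with $u\in U_{\mathbb Z}(\mathfrak a)$ of counit $0$. Let $\mathbb F$ be algebraically closed of characteristic $0$, let $\lambda$ be a dominant integral weight, and let $\mathbf a=(a_1,\dots,a_n)\in\mathbb F^n\setminus\{\mathbf 0\}$. * The graded local Weyl module $W^n_{\mathbb F}(\lambda)$ is the $U_{\mathbb F}(\mathfrak g[n])$-module generated by $v$ with defining relations $U_{\mathbb F}(\mathfrak n^+[n])^0v=U_{\mathbb F}(\mathfrak h[n]_0)^0v=0$, $\binom{h_i}{k}v=\binom{\lambda(h_i)}{k}v$ for all $i\in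 I$, $k\ge0$, and $(x_\alpha^-)^{(k)}v=0$ for all $\alpha\in R^+$, $k>\lambda(h_\alpha)$. * Let $\omega:U_{\mathbb F}(\mathfrak h\langle n\rangle)\to\mathbb F$ be any $\mathbb F$-algebra homomorphism with $\omega\big(\binom{h_i}{k}\big)=\binom{\lambda(h_i)}{k}$ for all $i\in I$, $k\ge 0$, and with $$\sum_{r\ge0}\omega(\Lambda_{i,t_j,r})u^r=(1-a_ju)^{\lambda(h_i)}\quad (i\in I,\ 1\le j\le n),\qquad \sum_{r\ge0}\Lambda_{i,t_j,r}u^r=\exp\Big(-\sum_{s\ge1}\frac{h_i\otimes t_j^s}{s}u^s\Big);$$ that is, $\omega$ is a functional whose tuple of polynomials is $\pmb\omega^{\lambda,\mathbf a}=\big((1-a_ju)^{\lambda(h_i)}\big)_{i,j}$. The local Weyl module $W_{\mathbb F}(\omega)$ is the $U_{\mathbb F}(\mathfrak g\langle n\rangle)$-module generated by $w$ with defining relations $U_{\mathbb F}(\mathfrak n^+\langle n\rangle)^0w=0$, $hw=\omega(h)w$ for all $h\in U_{\mathbb F}(\mathfrak h\langle n\rangle)$, and $(x_\alpha^-)^{(k)}w=0$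 for all $\alpha\in R^+$, $k>\lambda(h_\alpha)$. Then the automorphism of $\mathfrak g[n]$ over $\mathbb F$ given by $x\otimes f(t_1,\dots,t_n)\mapsto x\otimes f(t_1-a_1,\dots,t_n-a_n)$ induces an $\mathbb F$-algebra automorphism $\varphi_{\mathbf a}$ of $U_{\mathbb F}(\mathfrak g[n])$. For every $\omega$ as above, let $\mathrm{res}\,W_{\mathbb F}(\omega)$ be the $U_{\mathbb F}(\mathfrak g[n])$-module obtained from $W_{\mathbb F}(\omega)$ through the natural map $U_{\mathbb F}(\mathfrak g[n])\to U_{\mathbb F}(\mathfrak g\langle n\rangle)$. Then the pull-back $\varphi_{\mathbf a}^*(\mathrm{res}\,W_{\mathbb F}(\omega))$ is a quotient of $W^n_{\mathbb F}(\lambda)$: there is a surjective homomorphism of $U_{\mathbb F}(\mathfrak g[n])$-modules from $W^n_{\mathbb F}(\lambda)$ onto it. -/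

import Mathlib

open scoped TensorProduct

noncomputable section

namespace Multiloop

open LieAlgebra LieAlgebra.IsKilling LieModule

attribute [local instance] LieRing.ofAssociativeRing

/-! ### Chevalley bases -/

section Chevalley

variable {𝔤 : Type*} [LieRing 𝔤] [LieAlgebra ℂ 𝔤] [FiniteDimensional ℂ 𝔤] [IsSimple ℂ 𝔤]
  {𝔥 : LieSubalgebra ℂ 𝔤} [𝔥.IsCartanSubalgebra]

/-- The root `-α`. -/
def negRoot (α : 𝔥.root) : 𝔥.root :=
  ⟨-α.1, by
    have h : α.1.IsNonZero := (Finset.mem_filter.mp α.2).2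
    simpa using h⟩

/-- A Chevalley basis of the simple Lie algebra `𝔤` with respect to the Cartan subalgebra `𝔥`:
root vectors `x α`, for all roots `α`, with `[x_α, x_{-α}] = h_α` the coroot of `α`, and with
`[x_α, x_β] = ± (p + 1) x_{α + β}` whenever `α`, `β`, `α + β` are roots, where `p` is the largest
integer such that `β - p α` is a root. (The members of the basis are the `x α` together with
the simple coroots `h_i`.) -/
structure ChevalleyBasis (𝔥 : LieSubalgebra ℂ 𝔤) [𝔥.IsCartanSubalgebra] where
  /-- the root vectors -/
  x : 𝔥.root → 𝔤
  x_mem : ∀ α : 𝔥.root, x α ∈ rootSpace 𝔥 α.1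
  lie_x_negRoot : ∀ α : 𝔥.root, ⁅x α, x (negRoot α)⁆ = (coroot α.1 : 𝔤)
  lie_x_x : ∀ α β γ : 𝔥.root,
    (rootSystem 𝔥).root γ = (rootSystem 𝔥).root α + (rootSystem 𝔥).root β →
    ⁅x α, x β⁆ = ((rootSystem 𝔥).chainBotCoeff α β + 1) • x γ ∨
    ⁅x α, x β⁆ = -(((rootSystem 𝔥).chainBotCoeff α β + 1) • x γ)

/-- The members of the Chevalley basis: the root vectors `x_α` and the simple coroots `h_i`. -/
def ChevalleyBasis.vec (C : ChevalleyBasis 𝔥) (b : (rootSystem 𝔥).Base) :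
    𝔥.root ⊕ b.support → 𝔤 :=
  Sum.elim C.x fun i ↦ (coroot i.1.1 : 𝔤)

/-- The dominant integral weight `∑ i, l i • ω_i`, where the `ω_i` are the fundamental weights:
the linear form on `𝔥` with value `l i` at the simple coroot `h_i`. -/
def domWeight (b : (rootSystem 𝔥).Base) (l : b.support → ℕ) : Module.Dual ℂ 𝔥 :=
  b.toCoweightBasis.constr ℂ fun i ↦ (l i : ℂ)

end Chevalley

/-! ### Map algebras and their enveloping algebras

For an additive commutative monoid `M`, `loopAlgebra ℂ M 𝔤` is the Lie algebra `ℂ[M] ⊗ 𝔤`.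
With `M = Fin n →₀ ℕ` the ring `ℂ[M]` is `MvPolynomial (Fin n) ℂ`, and this is the multicurrent
algebra `𝔤[n]`; with `M = Fin n →₀ ℤ` the ring `ℂ[M]` is the ring of Laurent polynomials in `n`
variables, and this is the multiloop algebra `𝔤⟨n⟩`. The monomial `t ^ m` is
`AddMonoidAlgebra.single m 1`. -/

section Enveloping

variable {𝔤 : Type*} [LieRing 𝔤] [LieAlgebra ℂ 𝔤] {M N : Type*} [AddCommMonoid M] [AddCommMonoid N]

/-- The universal enveloping algebra of `ℂ[M] ⊗ 𝔤`. -/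
abbrev Env (M 𝔤 : Type*) [AddCommMonoid M] [LieRing 𝔤] [LieAlgebra ℂ 𝔤] : Type _ :=
  UniversalEnvelopingAlgebra ℂ (loopAlgebra ℂ M 𝔤)

/-- The element `y ⊗ t ^ m` of the enveloping algebra. -/
def elt (m : M) (y : 𝔤) : Env M 𝔤 :=
  UniversalEnvelopingAlgebra.ι ℂ (AddMonoidAlgebra.single m 1 ⊗ₜ[ℂ] y : loopAlgebra ℂ M 𝔤)

/-- The divided power `u ^ k / k!`. -/
def dividedPower (u : Env M 𝔤) (k : ℕ) : Env M 𝔤 := (k.factorial : ℂ)⁻¹ • u ^ k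

/-- The binomial `u (u - 1) ⋯ (u - k + 1) / k!`. -/
def binomial (u : Env M 𝔤) (k : ℕ) : Env M 𝔤 :=
  (k.factorial : ℂ)⁻¹ • Polynomial.aeval u (descPochhammer ℂ k)

/-- The counit of the enveloping algebra: it sends every element of the Lie algebra to `0`. -/
def counit (M 𝔤 : Type*) [AddCommMonoid M] [LieRing 𝔤] [LieAlgebra ℂ 𝔤] : Env M 𝔤 →ₐ[ℂ] ℂ :=
  UniversalEnvelopingAlgebra.lift ℂ 0

/-- For a set `S` spanning a Lie subalgebra `𝔞` of `ℂ[M] ⊗ 𝔤`, this is the subalgebra `U(𝔞)` of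
the enveloping algebra of `ℂ[M] ⊗ 𝔤`. -/
def envelope (S : Set (loopAlgebra ℂ M 𝔤)) : Subalgebra ℂ (Env M 𝔤) :=
  Algebra.adjoin ℂ (UniversalEnvelopingAlgebra.ι ℂ '' S)

/-- The map of enveloping algebras induced by a homomorphism `e` of exponent monoids; on the
Lie algebra it is `y ⊗ t ^ m ↦ y ⊗ t ^ (e m)`. -/
def envMap (𝔤 : Type*) [LieRing 𝔤] [LieAlgebra ℂ 𝔤] (e : M →+ N) : Env M 𝔤 →ₐ[ℂ] Env N 𝔤 :=
  UniversalEnvelopingAlgebra.lift ℂ ((UniversalEnvelopingAlgebra.ι ℂ).comp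
    (ExtendScalars.map (AddMonoidAlgebra.mapDomainAlgHom ℂ ℂ e) (LieHom.id : 𝔤 →ₗ⁅ℂ⁆ 𝔤)))

lemma envMap_elt (e : M →+ N) (m : M) (y : 𝔤) : envMap 𝔤 e (elt m y) = elt (e m) y := by
  rw [envMap, elt, UniversalEnvelopingAlgebra.lift_ι_apply, LieHom.comp_apply]
  simp only [elt, ExtendScalars.map]
  congr 1
  change TensorProduct.map _ _ _ = _
  simp

lemma elt_lie (m m' : M) (y z : 𝔤) :
    elt (m + m') ⁅y, z⁆ = elt m y * elt m' z - elt m' z * elt m y := by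
  rw [elt, elt, elt, ← LieRing.of_associative_ring_bracket, ← LieHom.map_lie,
    ExtendScalars.bracket_tmul, AddMonoidAlgebra.single_mul_single, one_mul]

end Enveloping

/-! ### Integral forms and hyperalgebras -/

section Hyper

variable {𝔤 : Type*} [LieRing 𝔤] [LieAlgebra ℂ 𝔤] [FiniteDimensional ℂ 𝔤] [IsSimple ℂ 𝔤]
  {𝔥 : LieSubalgebra ℂ 𝔤} [𝔥.IsCartanSubalgebra] (F : Type*) [Field F]
  (C : ChevalleyBasis 𝔥) (b : (rootSystem 𝔥).Base)
  (M : Type*) [AddCommMonoid M]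

/-- The integral form of the enveloping algebra of `ℂ[M] ⊗ 𝔤`: the subring generated by all the
divided powers `(x_α ⊗ t ^ m) ^ k / k!`, for `α` a (positive or negative) root. -/
def intForm : Subalgebra ℤ (Env M 𝔤) :=
  Algebra.adjoin ℤ {u | ∃ (α : 𝔥.root) (m : M) (k : ℕ), u = dividedPower (elt m (C.x α)) k}

/-- The integral form `U(𝔞) ∩ U_ℤ(ℂ[M] ⊗ 𝔤)` of `U(𝔞)`, where `S` spans the Lie subalgebra `𝔞`. -/
def subIntForm (S : Set (loopAlgebra ℂ M 𝔤)) : Subalgebra ℤ (Env M 𝔤) :=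
  intForm C M ⊓ (envelope S).restrictScalars ℤ

/-- The hyperalgebra of `ℂ[M] ⊗ 𝔤` over `F`. -/
abbrev Hyper : Type _ := F ⊗[ℤ] (intForm C M)

/-- The hyperalgebra over `F` of the Lie subalgebra spanned by `S`. -/
abbrev SubHyper (S : Set (loopAlgebra ℂ M 𝔤)) : Type _ := F ⊗[ℤ] (subIntForm C M S)

/-- The natural map from the hyperalgebra of a Lie subalgebra to the whole hyperalgebra. -/
def SubHyper.incl (S : Set (loopAlgebra ℂ M 𝔤)) : SubHyper F C M S →ₐ[F] Hyper F C M :=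
  Algebra.TensorProduct.map (AlgHom.id F F)
    (Subalgebra.inclusion (inf_le_left : subIntForm C M S ≤ intForm C M))

variable {M}

lemma dividedPower_mem (α : 𝔥.root) (m : M) (k : ℕ) :
    dividedPower (elt m (C.x α)) k ∈ intForm C M :=
  Algebra.subset_adjoin ⟨α, m, k, rfl⟩

lemma elt_x_mem (α : 𝔥.root) (m : M) : elt m (C.x α) ∈ intForm C M := by
  simpa [dividedPower] using dividedPower_mem C α m 1

lemma elt_coroot_mem (α : 𝔥.root) (m : M) : elt m (coroot α.1 : 𝔤) ∈ intForm C M := by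
  have h := elt_lie m 0 (C.x α) (C.x (negRoot α))
  rw [add_zero, C.lie_x_negRoot] at h
  rw [h]
  exact sub_mem (mul_mem (elt_x_mem C _ _) (elt_x_mem C _ _))
    (mul_mem (elt_x_mem C _ _) (elt_x_mem C _ _))

lemma elt_vec_mem (y : 𝔥.root ⊕ b.support) (m : M) : elt m (C.vec b y) ∈ intForm C M := by
  rcases y with α | i
  · exact elt_x_mem C α m
  · exact elt_coroot_mem C i.1 m

/-- The image in the hyperalgebra of the divided power `(x_α ⊗ t ^ m) ^ k / k!`. -/
def divPow (α : 𝔥.root) (m : M) (k : ℕ) : Hyper F C M :=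
  1 ⊗ₜ ⟨dividedPower (elt m (C.x α)) k, dividedPower_mem C α m k⟩

/-- A spanning set of `𝔫⁺ ⊗ ℂ[M]`. -/
def nPlus (M : Type*) [AddCommMonoid M] : Set (loopAlgebra ℂ M 𝔤) :=
  {z | ∃ (α : 𝔥.root) (f : AddMonoidAlgebra ℂ M), b.IsPos α ∧ z = f ⊗ₜ[ℂ] C.x α}

/-- A spanning set of `𝔥 ⊗ ℂ[M]`. -/
def cartan (𝔥 : LieSubalgebra ℂ 𝔤) (M : Type*) [AddCommMonoid M] : Set (loopAlgebra ℂ M 𝔤) :=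
  {z | ∃ (h : 𝔥) (f : AddMonoidAlgebra ℂ M), z = f ⊗ₜ[ℂ] (h : 𝔤)}

/-- A spanning set of `𝔥[n]₀ = 𝔥 ⊗ ℂ[n]₀`, where `ℂ[n]₀` consists of the polynomials `f` with
`f (0, …, 0) = 0`. -/
def cartanZero (𝔥 : LieSubalgebra ℂ 𝔤) (n : ℕ) : Set (loopAlgebra ℂ (Fin n →₀ ℕ) 𝔤) :=
  {z | ∃ (h : 𝔥) (f : MvPolynomial (Fin n) ℂ), MvPolynomial.eval 0 f = 0 ∧
    z = (f : AddMonoidAlgebra ℂ (Fin n →₀ ℕ)) ⊗ₜ[ℂ] (h : 𝔤)}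

/-- The image in the hyperalgebra of the elements of `U_ℤ(𝔞)` with zero counit, where `S` spans
the Lie subalgebra `𝔞`. As `U_ℤ(𝔞)` is the direct sum of `ℤ` and the kernel of its counit, the
augmentation ideal of the hyperalgebra of `𝔞` is the `F`-span of these elements. -/
def augmentation (S : Set (loopAlgebra ℂ M 𝔤)) : Set (Hyper F C M) :=
  {z | ∃ u : subIntForm C M S, counit M 𝔤 u = 0 ∧ z = SubHyper.incl F C M S (1 ⊗ₜ u)}

/-- The elements `(x_α^-)^{(k)}` for `α` a positive root and `k > λ(h_α)`, where
`λ = ∑ i, l i • ω_i`. -/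
def lowering (l : b.support → ℕ) (M : Type*) [AddCommMonoid M] : Set (Hyper F C M) :=
  {z | ∃ (α : 𝔥.root) (m k : ℕ), b.IsPos α ∧ domWeight b l (coroot α.1) = m ∧ m < k ∧
    z = divPow F C (negRoot α) 0 k}

end Hyper

/-! ### Local Weyl modules -/

section Weyl

variable {𝔤 : Type*} [LieRing 𝔤] [LieAlgebra ℂ 𝔤] [FiniteDimensional ℂ 𝔤] [IsSimple ℂ 𝔤]
  {𝔥 : LieSubalgebra ℂ 𝔤} [𝔥.IsCartanSubalgebra] (F : Type*) [Field F]
  (C : ChevalleyBasis 𝔥) (b : (rootSystem 𝔥).Base) (n : ℕ)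

/-- The relations `h - λ(h)` for `h` in the hyperalgebra of `𝔥`, for the generators
`h = binom (h_i ⊗ 1) k` of that hyperalgebra, at which `λ` has value `binom (λ(h_i)) k`. -/
def weightRel (l : b.support → ℕ) : Set (Hyper F C (Fin n →₀ ℕ)) :=
  {z | ∃ (i : b.support) (k : ℕ) (u : intForm C (Fin n →₀ ℕ)),
    (u : Env (Fin n →₀ ℕ) 𝔤) = binomial (elt 0 (coroot i.1.1 : 𝔤)) k ∧
    z = 1 ⊗ₜ u - algebraMap F _ ((l i).choose k : F)}

/-- The left ideal of the hyperalgebra of `𝔤[n]` generated by the defining relations of the graded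
local Weyl module of highest weight `λ = ∑ i, l i • ω_i`. -/
def gradedWeylIdeal (l : b.support → ℕ) :
    Submodule (Hyper F C (Fin n →₀ ℕ)) (Hyper F C (Fin n →₀ ℕ)) :=
  Submodule.span _ (augmentation F C (nPlus C b (Fin n →₀ ℕ)) ∪ augmentation F C (cartanZero 𝔥 n) ∪
    weightRel F C b n l ∪ lowering F C b l (Fin n →₀ ℕ))

/-- The graded local Weyl module `W(λ)` of the hyperalgebra of `𝔤[n]`, `λ = ∑ i, l i • ω_i`. -/
abbrev GradedWeyl (l : b.support → ℕ) : Type _ :=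
  Hyper F C (Fin n →₀ ℕ) ⧸ gradedWeylIdeal F C b n l

/-- The left ideal of the hyperalgebra of `𝔤⟨n⟩` generated by the defining relations of the local
Weyl module whose highest `ℓ`-weight is the functional `ω` on the hyperalgebra of `𝔥⟨n⟩`,
where `λ = ∑ i, l i • ω_i` is the weight of `ω`. -/
def localWeylIdeal (l : b.support → ℕ) (ω : SubHyper F C (Fin n →₀ ℤ) (cartan 𝔥 _) →ₐ[F] F) :
    Submodule (Hyper F C (Fin n →₀ ℤ)) (Hyper F C (Fin n →₀ ℤ)) :=
  Submodule.span _ (augmentation F C (nPlus C b (Fin n →₀ ℤ)) ∪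
    {z | ∃ h, z = SubHyper.incl F C (Fin n →₀ ℤ) (cartan 𝔥 _) h - algebraMap F _ (ω h)} ∪
    lowering F C b l (Fin n →₀ ℤ))

/-- The local Weyl module of the hyperalgebra of `𝔤⟨n⟩` of highest `ℓ`-weight `ω`. -/
abbrev LocalWeyl (l : b.support → ℕ) (ω : SubHyper F C (Fin n →₀ ℤ) (cartan 𝔥 _) →ₐ[F] F) :
    Type _ :=
  Hyper F C (Fin n →₀ ℤ) ⧸ localWeylIdeal F C b n l ω

/-! ### The `ℓ`-weight attached to a dominant weight and a point -/

/-- The coefficient of `u ^ r` in the power series `exp (- ∑_{s ≥ 1} (H s / s) u ^ s)`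
(the `k`-th term of the exponential series does not contribute to it for `k > r`). -/
def expCoeff {A : Type*} [Ring A] [Algebra F A] (H : ℕ → A) (r : ℕ) : A :=
  PowerSeries.coeff r (∑ k ∈ Finset.range (r + 1), (k.factorial : F)⁻¹ •
    (-PowerSeries.mk fun s ↦ if s = 0 then 0 else (s : F)⁻¹ • H s) ^ k)

lemma elt_coroot_mem_subIntForm {M : Type*} [AddCommMonoid M] (α : 𝔥.root) (m : M) :
    elt m (coroot α.1 : 𝔤) ∈ subIntForm C M (cartan 𝔥 M) := by
  refine Algebra.mem_inf.mpr ⟨elt_coroot_mem C α m, ?_⟩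
  rw [Subalgebra.mem_restrictScalars, elt]
  exact Algebra.subset_adjoin (Set.mem_image_of_mem _ ⟨coroot α.1, AddMonoidAlgebra.single m 1, rfl⟩)

/-- The element `h_i ⊗ t_j ^ s` of the hyperalgebra of `𝔥⟨n⟩`. -/
def cartanElt (i : b.support) (j : Fin n) (s : ℕ) : SubHyper F C (Fin n →₀ ℤ) (cartan 𝔥 _) :=
  1 ⊗ₜ ⟨elt (Finsupp.single j (s : ℤ)) (coroot i.1.1 : 𝔤), elt_coroot_mem_subIntForm C i.1 _⟩

/-- The image in the hyperalgebra of `𝔥⟨n⟩` (over a field of characteristic zero) of the element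
`Λ_{i, t_j, r}`, the coefficient of `u ^ r` in `exp (- ∑_{s ≥ 1} (h_i ⊗ t_j ^ s / s) u ^ s)`. -/
def Lam (i : b.support) (j : Fin n) (r : ℕ) : SubHyper F C (Fin n →₀ ℤ) (cartan 𝔥 _) :=
  expCoeff F (cartanElt F C b n i j) r

variable {n}

/-- The `(i, j)` component `(1 - a_j u) ^ λ(h_i)` of the tuple of polynomials `ω^{λ, a}`. -/
def drinfeld (l : b.support → ℕ) (a : Fin n → F) (i : b.support) (j : Fin n) : Polynomial F :=
  (1 - Polynomial.C (a j) * Polynomial.X) ^ l i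

/-- The algebra homomorphism `ω` from the hyperalgebra of `𝔥⟨n⟩` to `F` restricts to the tuple of
polynomials `ω^{λ, a}`: it has the value `binom (λ(h_i)) k` at `binom h_i k`, and its value at
`Λ_{i, t_j, r}` is the coefficient of `u ^ r` in `(1 - a_j u) ^ λ(h_i)`. -/
structure IsLWeight (l : b.support → ℕ) (a : Fin n → F)
    (ω : SubHyper F C (Fin n →₀ ℤ) (cartan 𝔥 _) →ₐ[F] F) : Prop where
  binom : ∀ (i : b.support) (k : ℕ) (u : subIntForm C (Fin n →₀ ℤ) (cartan 𝔥 _)),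
    (u : Env (Fin n →₀ ℤ) 𝔤) = binomial (elt 0 (coroot i.1.1 : 𝔤)) k →
    ω (1 ⊗ₜ u) = ((l i).choose k : F)
  lam : ∀ (i : b.support) (j : Fin n) (r : ℕ),
    ω (Lam F C b n i j r) = (drinfeld F b l a i j).coeff r

/-! ### Restriction and the shift -/

variable (n) in
/-- The map from the hyperalgebra of `𝔤[n]` to that of `𝔤⟨n⟩` induced by the inclusion of the
polynomials in the Laurent polynomials. -/
def currentToLoop : Hyper F C (Fin n →₀ ℕ) →ₐ[F] Hyper F C (Fin n →₀ ℤ) :=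
  let e : (Fin n →₀ ℕ) →+ (Fin n →₀ ℤ) := Finsupp.mapRange.addMonoidHom (Nat.castAddMonoidHom ℤ)
  Algebra.TensorProduct.map (AlgHom.id F F)
    ((((envMap 𝔤 e).restrictScalars ℤ).comp (intForm C (Fin n →₀ ℕ)).val).codRestrict
      (intForm C (Fin n →₀ ℤ)) (by
        rintro ⟨u, hu⟩
        have h : intForm C (Fin n →₀ ℕ) ≤
            (intForm C (Fin n →₀ ℤ)).comap ((envMap 𝔤 e).restrictScalars ℤ) := by
          refine Algebra.adjoin_le ?_
          rintro _ ⟨α, m, k, rfl⟩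
          simpa [dividedPower, envMap_elt] using dividedPower_mem C α (e m) k
        exact h hu))

/-- The image of `y ⊗ f` in the hyperalgebra of `𝔤[n]`, where `y` is a member of the Chevalley
basis and `f` is a polynomial with coefficients in `F`. -/
def currentElt (y : 𝔥.root ⊕ b.support) (f : MvPolynomial (Fin n) F) : Hyper F C (Fin n →₀ ℕ) :=
  ∑ s ∈ f.support, f.coeff s ⊗ₜ ⟨elt s (C.vec b y), elt_vec_mem C b y s⟩

/-- `φ` is the automorphism of the hyperalgebra of `𝔤[n]` induced by the automorphism
`y ⊗ f(t) ↦ y ⊗ f(t - a)` of the Lie algebra `𝔤[n]` over `F`. (In characteristic zero the elements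
`y ⊗ f` generate the hyperalgebra, so that there is at most one such `φ`.) -/
def IsShift (a : Fin n → F) (φ : Hyper F C (Fin n →₀ ℕ) ≃ₐ[F] Hyper F C (Fin n →₀ ℕ)) : Prop :=
  ∀ (y : 𝔥.root ⊕ b.support) (f : MvPolynomial (Fin n) F),
    φ (currentElt F C b y f) = currentElt F C b y
      (MvPolynomial.aeval (fun j ↦ MvPolynomial.X j - MvPolynomial.C (a j)) f)

end Weyl

/-- The pull-back of the `B`-module `W` along the ring homomorphism `σ : A → B`. -/
def Pullback {A B : Type*} [Ring A] [Ring B] (_σ : A →+* B) (W : Type*) [AddCommGroup W]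
    [Module B W] : Type _ := W

instance {A B : Type*} [Ring A] [Ring B] (σ : A →+* B) (W : Type*) [AddCommGroup W]
    [Module B W] : AddCommGroup (Pullback σ W) := inferInstanceAs (AddCommGroup W)

instance {A B : Type*} [Ring A] [Ring B] (σ : A →+* B) (W : Type*) [AddCommGroup W]
    [Module B W] : Module A (Pullback σ W) := Module.compHom W σ

end Multiloop

end

/-!
# Local Weyl modules of multiloop algebras are quotients of graded local Weyl modules

Two facts have to be proved about the generator `w` of the local Weyl module attached to `λ` and `a`:
it satisfies the defining relations of the graded local Weyl module after the shift `t ↦ t - a`, and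
the hyperalgebra of `𝔤[n]` already generates the module from it.

**The shift.** No Poincaré–Birkhoff–Witt theorem for the integral form is needed. Let `B` be an
algebra over a field `F` of characteristic zero, and let `X m : L → B` be additive maps on the lattice
`L` of the Chevalley basis satisfying the bracket relations of `y ⊗ t ^ m`. They define a homomorphism
from the complex enveloping algebra to `ℂ ⊗_ℤ B`. It maps the integral form into `1 ⊗ B`, as `B`
contains the divided powers of its elements, and `1 ⊗ B` is a copy of `B`, since `ℚ` is a direct
summand of `ℂ`. This gives the universal property `hyperLift` of the hyperalgebra, and
with it the functoriality `hyperMap` in the ring of coefficients: the shift comes from the translation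
of polynomials, the restriction map from the inclusion of polynomials in Laurent polynomials.

**The relations.** The polynomials `(1 - a_j u) ^ λ(h_i)` say that `h_i ⊗ t_j ^ s` acts on `w` by
`λ(h_i) a_j ^ s` (`eq_mul_pow_of_expCoeff`), so that `h_i ⊗ (t_j - a_j) ^ s` kills `w` for `s > 0`. It
has to be shown that `h_i ⊗ (t_j - a_j) g` kills `w` for every Laurent polynomial `g`. This is a
computation with the copy of `𝔰𝔩₂ ⊗ F⟨n⟩` of the root (`k_mul_smul_eq_zero`). Put `f = t_j - a_j`.
Applying powers of `x⁺ ⊗ f` to `(x⁻) ^ (N + 1) w = 0` gives `(x⁻ ⊗ f ^ N) w = 0`, hence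
`(h ⊗ f ^ (N + 1) g) w = 0` for all `g`. The exponent is then lowered to `1`: if `h ⊗ u ^ s` kills `w`
for all `s ≥ 2`, while `h ⊗ u` acts by `c`, then `(x⁺ ⊗ u) ^ m (x⁻) ^ m w = m! c ^ m w`, so `c = 0`.

**Surjectivity.** The same computation shows that `y ⊗ (t_j - a_j) ^ N g` kills `w` for all `y ∈ 𝔤`,
all `g` and some `N`. If `𝔤 ⊗ f g` kills `w` for all `g`, then it kills the whole module
(`cur_mul_smul_smul_eq_zero`), and modulo powers of the `t_j - a_j` every Laurent polynomial is a polynomial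
(`exists_sub_toLaurent_mem`).
-/


open scoped TensorProduct

noncomputable section

namespace Multiloop

open LieAlgebra LieAlgebra.IsKilling LieModule

attribute [local instance] LieRing.ofAssociativeRing

/-! ### The Chevalley lattice and positivity of coroots -/

section Lattice

variable {𝔤 : Type*} [LieRing 𝔤] [LieAlgebra ℂ 𝔤] [FiniteDimensional ℂ 𝔤] [IsSimple ℂ 𝔤]
  {𝔥 : LieSubalgebra ℂ 𝔤} [𝔥.IsCartanSubalgebra]

omit [IsSimple ℂ 𝔤] in
lemma root_isNonZero (α : 𝔥.root) : α.1.IsNonZero := (Finset.mem_filter.mp α.2).2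

lemma ChevalleyBasis.x_ne_zero (C : ChevalleyBasis 𝔥) (α : 𝔥.root) : C.x α ≠ 0 := by
  intro h
  have h1 := C.lie_x_negRoot α
  rw [h, zero_lie] at h1
  have h2 : coroot α.1 = 0 := by
    apply Subtype.ext; simpa using h1.symm
  exact root_isNonZero α (coroot_eq_zero_iff.mp h2)

lemma ChevalleyBasis.span_x (C : ChevalleyBasis 𝔥) (α : 𝔥.root) :
    (rootSpace 𝔥 α.1).toSubmodule = Submodule.span ℂ {C.x α} := by
  have h := finrank_rootSpace_eq_one α.1 (root_isNonZero α)
  refine le_antisymm (fun y hy ↦ ?_) ?_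
  · obtain ⟨c, hc⟩ := (finrank_eq_one_iff_of_nonzero' (⟨C.x α, C.x_mem α⟩ : rootSpace 𝔥 α.1)
      (fun h ↦ C.x_ne_zero α (congrArg Subtype.val h))).mp h ⟨y, hy⟩
    exact Submodule.mem_span_singleton.mpr ⟨c, congrArg Subtype.val hc⟩
  · rw [Submodule.span_singleton_le_iff_mem]
    exact C.x_mem α

/-- The root vectors and the simple coroots lie in different weight spaces of the Cartan
subalgebra. -/
lemma linearIndependent_vec (C : ChevalleyBasis 𝔥) (b : (rootSystem 𝔥).Base) :
    LinearIndependent ℂ (C.vec b) := by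
  have hind := LieSubmodule.iSupIndep_toSubmodule.mpr (iSupIndep_genWeightSpace ℂ 𝔥 𝔤)
  refine LinearIndependent.sum_type ?_ ?_ ?_
  · refine iSupIndep.linearIndependent (fun α : 𝔥.root ↦ (rootSpace 𝔥 α.1).toSubmodule)
      (hind.comp (f := fun α : 𝔥.root ↦ (α.1 : 𝔥 → ℂ)) ?_) C.x_mem C.x_ne_zero
    intro α β h
    exact Subtype.ext (DFunLike.coe_injective h)
  · have h1 : LinearIndependent ℂ (fun i : b.support ↦ coroot i.1.1) :=
      b.linearIndepOn_coroot
    exact h1.map' 𝔥.toSubmodule.subtype (Submodule.ker_subtype _)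
  · have h0 := hind (0 : 𝔥 → ℂ)
    refine (h0.mono ?_ ?_).symm
    · rw [Submodule.span_le]
      rintro _ ⟨i, rfl⟩
      have : (coroot i.1.1 : 𝔤) ∈ (rootSpace 𝔥 (0 : 𝔥 → ℂ)) := by
        simp
      exact this
    · rw [Submodule.span_le]
      rintro _ ⟨α, rfl⟩
      refine Submodule.mem_iSup_of_mem (α.1 : 𝔥 → ℂ) (Submodule.mem_iSup_of_mem ?_ (C.x_mem α))
      exact root_isNonZero α

lemma coroot_mem_span (b : (rootSystem 𝔥).Base) (α : 𝔥.root) :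
    (coroot α.1 : 𝔤) ∈ Submodule.span ℤ (Set.range fun i : b.support ↦ (coroot i.1.1 : 𝔤)) := by
  have h := b.coroot_mem_span_int α
  have h' := Submodule.mem_map_of_mem (f := (𝔥.toSubmodule.subtype.restrictScalars ℤ)) h
  rw [Submodule.map_span] at h'
  refine Submodule.span_mono ?_ h'
  rintro _ ⟨_, ⟨i, hi, rfl⟩, rfl⟩
  exact ⟨⟨i, hi⟩, rfl⟩

lemma top_le_span_vec (C : ChevalleyBasis 𝔥) (b : (rootSystem 𝔥).Base) :
    ⊤ ≤ Submodule.span ℂ (Set.range (C.vec b)) := by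
  have h := congrArg LieSubmodule.toSubmodule (iSup_genWeightSpace_eq_top' ℂ 𝔥 𝔤)
  rw [LieSubmodule.iSup_toSubmodule, LieSubmodule.top_toSubmodule] at h
  rw [← h]
  refine iSup_le fun χ ↦ ?_
  by_cases hχ : χ.IsZero
  · have h2 : (genWeightSpace 𝔤 χ).toSubmodule = 𝔥.toSubmodule := by
      rw [hχ.eq]
      exact congrArg LieSubmodule.toSubmodule (rootSpace_zero_eq ℂ 𝔤 𝔥)
    rw [h2]
    have h3 := congrArg (Submodule.map 𝔥.toSubmodule.subtype) b.span_coroot_support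
    rw [RootPairing.corootSpan, RootPairing.IsRootSystem.span_coroot_eq_top, Submodule.map_span,
      Submodule.map_subtype_top] at h3
    rw [← h3]
    refine Submodule.span_mono ?_
    rintro _ ⟨_, ⟨i, hi, rfl⟩, rfl⟩
    exact ⟨Sum.inr ⟨i, hi⟩, rfl⟩
  · have := C.span_x ⟨χ, by simpa using hχ⟩
    simp only at this
    rw [this, Submodule.span_singleton_le_iff_mem]
    exact Submodule.subset_span ⟨Sum.inl _, rfl⟩

/-- The Chevalley basis, as a basis of the complex vector space `𝔤`. -/
def ChevalleyBasis.basis (C : ChevalleyBasis 𝔥) (b : (rootSystem 𝔥).Base) :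
    Module.Basis (𝔥.root ⊕ b.support) ℂ 𝔤 :=
  Module.Basis.mk (linearIndependent_vec C b) (top_le_span_vec C b)

@[simp]
lemma ChevalleyBasis.basis_apply (C : ChevalleyBasis 𝔥) (b : (rootSystem 𝔥).Base)
    (y : 𝔥.root ⊕ b.support) : C.basis b y = C.vec b y := by
  simp [ChevalleyBasis.basis]

lemma lie_coroot_x (C : ChevalleyBasis 𝔥) (α β : 𝔥.root) :
    ⁅(coroot α.1 : 𝔤), C.x β⁆ = (rootSystem 𝔥).pairingIn ℤ β α • C.x β := by
  have h := lie_eq_smul_of_mem_rootSpace (C.x_mem β) (coroot α.1)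
  rw [LieSubalgebra.coe_bracket_of_module] at h
  rw [h, ← Int.cast_smul_eq_zsmul ℂ]
  congr 1
  have := (rootSystem 𝔥).algebraMap_pairingIn ℤ β α
  simpa using this.symm

lemma coe_negRoot (α : 𝔥.root) : ((negRoot α).1 : 𝔥 → ℂ) = -α.1 := rfl

lemma lie_coroot_coroot (α β : 𝔥.root) : ⁅(coroot α.1 : 𝔤), (coroot β.1 : 𝔤)⁆ = 0 := by
  rw [← LieSubalgebra.coe_bracket, trivial_lie_zero]
  rfl

lemma lie_x_x_mem (C : ChevalleyBasis 𝔥) (b : (rootSystem 𝔥).Base) (α β : 𝔥.root) :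
    ⁅C.x α, C.x β⁆ ∈ Submodule.span ℤ (Set.range (C.vec b)) := by
  have hm := lie_mem_genWeightSpace_of_mem_genWeightSpace (C.x_mem α) (C.x_mem β)
  by_cases h0 : (α.1 + β.1 : 𝔥 → ℂ) = 0
  · have hβ : β = negRoot α := by
      refine Subtype.ext (DFunLike.coe_injective ?_)
      rw [coe_negRoot]
      exact (neg_eq_of_add_eq_zero_right h0).symm
    rw [hβ, C.lie_x_negRoot]
    refine Submodule.span_mono ?_ (coroot_mem_span b α)
    rintro _ ⟨i, rfl⟩
    exact ⟨Sum.inr i, rfl⟩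
  by_cases h1 : rootSpace 𝔥 (α.1 + β.1 : 𝔥 → ℂ) = ⊥
  · replace hm : ⁅C.x α, C.x β⁆ ∈ rootSpace 𝔥 (α.1 + β.1 : 𝔥 → ℂ) := hm
    rw [h1, LieSubmodule.mem_bot] at hm
    rw [hm]
    exact zero_mem _
  · let γ : Weight ℂ 𝔥 𝔤 := ⟨_, h1⟩
    have hγ : γ ∈ 𝔥.root := by
      simp only [LieSubalgebra.root, Finset.mem_filter, Finset.mem_univ, true_and]
      exact h0
    have hx : C.x ⟨γ, hγ⟩ ∈ Submodule.span ℤ (Set.range (C.vec b)) :=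
      Submodule.subset_span ⟨Sum.inl _, rfl⟩
    rcases C.lie_x_x α β ⟨γ, hγ⟩ (by ext; rfl) with h | h
    · rw [h]; exact nsmul_mem hx _
    · rw [h]; exact neg_mem (nsmul_mem hx _)

/-- The lattice spanned by a Chevalley basis; it is closed under the bracket. -/
def ChevalleyBasis.lattice (C : ChevalleyBasis 𝔥) (b : (rootSystem 𝔥).Base) :
    LieSubalgebra ℤ 𝔤 where
  __ := Submodule.span ℤ (Set.range (C.vec b))
  lie_mem' := by
    intro y z hy hz
    change y ∈ Submodule.span ℤ (Set.range (C.vec b)) at hy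
    change z ∈ Submodule.span ℤ (Set.range (C.vec b)) at hz
    change ⁅y, z⁆ ∈ Submodule.span ℤ (Set.range (C.vec b))
    have hx : ∀ α, C.x α ∈ Submodule.span ℤ (Set.range (C.vec b)) :=
      fun α ↦ Submodule.subset_span ⟨Sum.inl _, rfl⟩
    induction hy using Submodule.span_induction with
    | zero => simp
    | add _ _ _ _ h h' => rw [add_lie]; exact add_mem h h'
    | smul c _ _ h => rw [smul_lie]; exact Submodule.smul_mem _ _ h
    | mem y hy =>
      obtain ⟨β, rfl⟩ := hy
      induction hz using Submodule.span_induction with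
      | zero => simp
      | add _ _ _ _ h h' => rw [lie_add]; exact add_mem h h'
      | smul c _ _ h => rw [lie_smul]; exact Submodule.smul_mem _ _ h
      | mem z hz =>
        obtain ⟨γ, rfl⟩ := hz
        rcases β with α | i <;> rcases γ with β | j <;>
          simp only [ChevalleyBasis.vec, Sum.elim_inl, Sum.elim_inr]
        · exact lie_x_x_mem C b α β
        · rw [← lie_skew, lie_coroot_x]
          exact neg_mem (zsmul_mem (hx _) _)
        · rw [lie_coroot_x]
          exact zsmul_mem (hx _) _
        · rw [lie_coroot_coroot]; exact zero_mem _

lemma vec_mem_lattice (C : ChevalleyBasis 𝔥) (b : (rootSystem 𝔥).Base) (y : 𝔥.root ⊕ b.support) :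
    C.vec b y ∈ C.lattice b :=
  Submodule.subset_span ⟨y, rfl⟩

lemma coroot_mem_lattice (C : ChevalleyBasis 𝔥) (b : (rootSystem 𝔥).Base) (α : 𝔥.root) :
    (coroot α.1 : 𝔤) ∈ C.lattice b := by
  refine Submodule.span_mono ?_ (coroot_mem_span b α)
  rintro _ ⟨i, rfl⟩
  exact ⟨Sum.inr i, rfl⟩

lemma domWeight_coroot_simple (b : (rootSystem 𝔥).Base) (l : b.support → ℕ) (i : b.support) :
    domWeight b l (coroot i.1.1) = l i := by
  have h := b.toCoweightBasis.constr_basis ℂ (fun i ↦ (l i : ℂ)) i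
  rwa [b.toCoweightBasis_apply] at h

lemma isPos_or_isPos_negRoot (b : (rootSystem 𝔥).Base) (α : 𝔥.root) :
    b.IsPos α ∨ b.IsPos (negRoot α) := by
  have h := RootPairing.Base.IsPos.or_neg b α
  have e : negRoot α = (rootSystem 𝔥).reflectionPerm α α := by
    apply (rootSystem 𝔥).root.injective
    rw [RootPairing.root_reflectionPerm, RootPairing.reflection_apply_self]
    rfl
  rw [e]
  exact h

/-- A dominant weight takes natural number values on the coroots of positive roots. The point is
that `(α, α) α^∨ = 2 α` under the identification given by the canonical form, so that the coroot of a
positive root is a nonnegative combination of simple coroots. -/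
lemma exists_domWeight_coroot_eq (b : (rootSystem 𝔥).Base) (l : b.support → ℕ) {α : 𝔥.root}
    (hα : b.IsPos α) : ∃ m : ℕ, domWeight b l (coroot α.1) = m := by
  have hint : ∃ z : ℤ, domWeight b l (coroot α.1) = z := by
    have h := b.coroot_mem_span_int α
    rw [rootSystem_coroot_apply] at h
    generalize coroot α.1 = x at h
    induction h using Submodule.span_induction with
    | zero => exact ⟨0, by simp⟩
    | add x y _ _ hx hy =>
      obtain ⟨z, hz⟩ := hx
      obtain ⟨z', hz'⟩ := hy
      exact ⟨z + z', by simp [hz, hz']⟩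
    | smul c x _ hx =>
      obtain ⟨z, hz⟩ := hx
      exact ⟨c * z, by simp [hz]⟩
    | mem x hx =>
      obtain ⟨i, hi, rfl⟩ := hx
      exact ⟨l ⟨i, hi⟩, by
        simpa using domWeight_coroot_simple b l ⟨i, hi⟩⟩
  obtain ⟨z, hz⟩ := hint
  suffices 0 ≤ z by
    lift z to ℕ using this
    exact ⟨z, by simpa using hz⟩
  obtain ⟨f, hf, hroot⟩ : ∃ f : 𝔥.root → ℕ, f.support ⊆ b.support ∧
      (rootSystem 𝔥).root α = ∑ j ∈ b.support, f j • (rootSystem 𝔥).root j := by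
    obtain ⟨f, hf, h | h⟩ := b.exists_root_eq_sum_nat_or_neg α
    · exact ⟨f, hf, h⟩
    · exfalso
      have hh := RootPairing.Base.height_eq_sum (b := b) (i := α) (f := fun j ↦ -(f j : ℤ))
        (by simp [h])
      have hα' : 0 < b.height α := hα
      rw [hh, Finset.sum_neg_distrib, neg_pos] at hα'
      exact absurd hα' (not_lt.mpr (Finset.sum_nonneg fun _ _ ↦ by positivity))
  -- the squared length `q j` of a root is a positive integer
  have hq : ∀ j : 𝔥.root, ∃ q : ℤ, 0 < q ∧
      (rootSystem 𝔥).RootForm ((rootSystem 𝔥).root j) ((rootSystem 𝔥).root j) = q := by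
    intro j
    refine ⟨∑ k : 𝔥.root, (rootSystem 𝔥).pairingIn ℤ j k * (rootSystem 𝔥).pairingIn ℤ j k, ?_, ?_⟩
    · refine Finset.sum_pos' (fun _ _ ↦ mul_self_nonneg _) ⟨j, Finset.mem_univ _, ?_⟩
      simp
    · rw [RootPairing.rootForm_root_self]
      push_cast
      refine Finset.sum_congr rfl fun k _ ↦ ?_
      have := (rootSystem 𝔥).algebraMap_pairingIn ℤ j k
      rw [← this]
      simp
  choose q hq0 hq using hq
  have hpol : ∀ j : 𝔥.root, (2 : ℂ) * domWeight b l
      ((rootSystem 𝔥).Polarization ((rootSystem 𝔥).root j)) = q j * domWeight b l (coroot j.1) := by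
    intro j
    have h := congrArg (domWeight b l) ((rootSystem 𝔥).rootForm_self_smul_coroot j)
    rw [hq, map_smul, rootSystem_coroot_apply, smul_eq_mul] at h
    rw [h]
    simp
  have h1 := hpol α
  have h2 : (2 : ℂ) * domWeight b l ((rootSystem 𝔥).Polarization ((rootSystem 𝔥).root α)) =
      ∑ j ∈ b.support.attach, (f j.1 : ℂ) * ((q j.1 : ℂ) * (l j : ℂ)) := by
    rw [hroot, ← Finset.sum_attach, map_sum, map_sum, Finset.mul_sum]
    refine Finset.sum_congr rfl fun j _ ↦ ?_
    rw [map_nsmul, map_nsmul, nsmul_eq_mul, mul_left_comm, hpol, domWeight_coroot_simple]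
  rw [h2, hz] at h1
  have h3 : ∑ j ∈ b.support.attach, (f j.1 : ℤ) * (q j.1 * (l j : ℤ)) = q α * z := by
    exact_mod_cast h1
  have h4 : 0 ≤ q α * z := by
    rw [← h3]
    exact Finset.sum_nonneg fun j _ ↦ mul_nonneg (by positivity)
      (mul_nonneg (hq0 _).le (by positivity))
  exact nonneg_of_mul_nonneg_right h4 (hq0 α)

end Lattice

/-! ### The universal property of the integral form over a field of characteristic zero -/

section Universal

variable {𝔤 : Type*} [LieRing 𝔤] [LieAlgebra ℂ 𝔤] {M : Type*} [AddCommMonoid M]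

/-- The linear map `y ↦ y ⊗ t ^ m` from `𝔤` to the enveloping algebra. -/
def eltHom (m : M) : 𝔤 →ₗ[ℂ] Env M 𝔤 :=
  (UniversalEnvelopingAlgebra.ι ℂ : loopAlgebra ℂ M 𝔤 →ₗ⁅ℂ⁆ Env M 𝔤).toLinearMap ∘ₗ
    TensorProduct.mk ℂ (AddMonoidAlgebra ℂ M) 𝔤 (AddMonoidAlgebra.single m 1)

lemma eltHom_apply (m : M) (y : 𝔤) : eltHom m y = elt m y := rfl

/-- The algebra homomorphism on the enveloping algebra of `L` induced by a linear map from `L` to an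
associative algebra which sends brackets to commutators. -/
def liftOfCommutator {L A : Type*} [LieRing L] [LieAlgebra ℂ L] [Ring A] [Algebra ℂ A]
    (f : L →ₗ[ℂ] A) (hf : ∀ u v, f ⁅u, v⁆ = f u * f v - f v * f u) :
    UniversalEnvelopingAlgebra ℂ L →ₐ[ℂ] A :=
  UniversalEnvelopingAlgebra.lift ℂ { f with map_lie' := fun {u v} ↦ hf u v }

lemma liftOfCommutator_ι {L A : Type*} [LieRing L] [LieAlgebra ℂ L] [Ring A] [Algebra ℂ A]
    (f : L →ₗ[ℂ] A) (hf : ∀ u v, f ⁅u, v⁆ = f u * f v - f v * f u) (u : L) :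
    liftOfCommutator f hf (UniversalEnvelopingAlgebra.ι ℂ u) = f u :=
  UniversalEnvelopingAlgebra.lift_ι_apply ..

/-- The inclusion of `ℚ` in `ℂ` splits as a map of vector spaces; the additive retraction serves to
recover an `F`-algebra `B` from `ℂ ⊗_ℤ B`. -/
lemma exists_addMonoidHom_complex (F : Type*) [Field F] [CharZero F] :
    ∃ p : ℂ →+ F, p 1 = 1 := by
  obtain ⟨g, hg⟩ := LinearMap.exists_leftInverse_of_injective (Algebra.linearMap ℚ ℂ)
    (LinearMap.ker_eq_bot.mpr (algebraMap ℚ ℂ).injective)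
  refine ⟨(algebraMap ℚ F).toAddMonoidHom.comp g.toAddMonoidHom, ?_⟩
  have : g 1 = 1 := by simpa using LinearMap.congr_fun hg 1
  simp [this]

section Retract

variable {F : Type*} [Field F] {B : Type*} [Ring B] [Algebra F B]

/-- The additive map `ℂ ⊗ B → B` with `z ⊗ u ↦ p z • u`. -/
def retract (B : Type*) [Ring B] [Algebra F B] (p : ℂ →+ F) : ℂ ⊗[ℤ] B →ₗ[ℤ] B :=
  TensorProduct.lift (LinearMap.mk₂ ℤ (fun z u ↦ p z • u) (by simp [add_smul])
    (fun c z u ↦ by rw [map_zsmul, smul_assoc]) (by simp) (fun c z u ↦ smul_comm _ _ _))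

lemma retract_tmul (p : ℂ →+ F) (z : ℂ) (u : B) : retract B p (z ⊗ₜ u) = p z • u := rfl

lemma inv_factorial_smul_tmul [CharZero F] (k : ℕ) (u : B) :
    ((k.factorial : ℂ)⁻¹ • (1 ⊗ₜ u) : ℂ ⊗[ℤ] B) = 1 ⊗ₜ ((k.factorial : F)⁻¹ • u) := by
  have hF : (k.factorial : F) ≠ 0 := by exact_mod_cast k.factorial_ne_zero
  have hC : (k.factorial : ℂ) ≠ 0 := by exact_mod_cast k.factorial_ne_zero
  have h : u = (k.factorial : ℤ) • ((k.factorial : F)⁻¹ • u) := by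
    rw [← Int.cast_smul_eq_zsmul F, smul_smul]
    simp [hF]
  conv_lhs => rw [h]
  rw [← TensorProduct.smul_tmul, TensorProduct.smul_tmul']
  congr 1
  simp [hC]

end Retract

variable [FiniteDimensional ℂ 𝔤] [IsSimple ℂ 𝔤]
  {𝔥 : LieSubalgebra ℂ 𝔤} [𝔥.IsCartanSubalgebra] {F : Type*} [Field F]
  {C : ChevalleyBasis 𝔥} {b : (rootSystem 𝔥).Base} {B : Type*} [Ring B]

lemma elt_mem_intForm (m : M) {y : 𝔤} (hy : y ∈ C.lattice b) : elt m y ∈ intForm C M := by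
  change y ∈ Submodule.span ℤ (Set.range (C.vec b)) at hy
  rw [← eltHom_apply]
  induction hy using Submodule.span_induction with
  | zero => simp
  | add _ _ _ _ h h' => rw [map_add]; exact add_mem h h'
  | smul c _ _ h => rw [map_zsmul]; exact zsmul_mem h c
  | mem y hy =>
    obtain ⟨β, rfl⟩ := hy
    exact elt_vec_mem C b β m

/-- A family of additive maps `X m`, `m ∈ M`, from the Chevalley lattice to a ring which respects the
bracket of the map algebra; `X m y` plays the role of `y ⊗ t ^ m`. -/
def IsCurrentRep (X : M → C.lattice b →+ B) : Prop :=
  ∀ m m' y z, X (m + m') ⁅y, z⁆ = X m y * X m' z - X m' z * X m y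

section Lift

variable (X : M → C.lattice b →+ B)

/-- The `ℂ`-linear extension of `X m` to `𝔤`. -/
def currentLin (m : M) : 𝔤 →ₗ[ℂ] ℂ ⊗[ℤ] B :=
  (C.basis b).constr ℂ fun β ↦ 1 ⊗ₜ X m ⟨C.vec b β, vec_mem_lattice C b β⟩

omit [AddCommMonoid M] in
lemma currentLin_apply (m : M) (y : C.lattice b) : currentLin X m y = 1 ⊗ₜ X m y := by
  obtain ⟨y, hy⟩ := y
  have hy' := hy
  change y ∈ Submodule.span ℤ (Set.range (C.vec b)) at hy'
  induction hy' using Submodule.span_induction with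
  | zero =>
    have : (⟨0, hy⟩ : C.lattice b) = 0 := rfl
    rw [this]; simp
  | add y z hy1 hz1 h h' =>
    have : (⟨y + z, hy⟩ : C.lattice b) = ⟨y, hy1⟩ + ⟨z, hz1⟩ := rfl
    rw [this, map_add, TensorProduct.tmul_add, ← h hy1, ← h' hz1]
    simp
  | smul c y hy1 h =>
    have : (⟨c • y, hy⟩ : C.lattice b) = c • ⟨y, hy1⟩ := rfl
    rw [this, map_zsmul, TensorProduct.tmul_smul, ← h hy1]
    simp
  | mem y hy1 =>
    obtain ⟨β, rfl⟩ := hy1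
    have h := (C.basis b).constr_basis ℂ
      (fun β ↦ (1 : ℂ) ⊗ₜ[ℤ] X m ⟨C.vec b β, vec_mem_lattice C b β⟩) β
    rw [ChevalleyBasis.basis_apply] at h
    exact h

/-- The linear map `ℂ[M] ⊗ 𝔤 → ℂ ⊗ B` which extends the maps `X m`. -/
def currentTensor : loopAlgebra ℂ M 𝔤 →ₗ[ℂ] ℂ ⊗[ℤ] B :=
  TensorProduct.lift ((Finsupp.lsum ℂ fun m ↦ LinearMap.toSpanSingleton ℂ _ (currentLin X m)) ∘ₗ
    (AddMonoidAlgebra.coeffLinearEquiv ℂ).toLinearMap)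

omit [AddCommMonoid M] in
lemma currentTensor_single (m : M) (c : ℂ) (y : 𝔤) :
    currentTensor X (AddMonoidAlgebra.single m c ⊗ₜ y) = c • currentLin X m y := by
  simp [currentTensor]

variable {X}

lemma currentLin_lie (hX : IsCurrentRep X) (m m' : M) (y z : 𝔤) :
    currentLin X (m + m') ⁅y, z⁆ =
      currentLin X m y * currentLin X m' z - currentLin X m' z * currentLin X m y := by
  have hy : y ∈ Submodule.span ℂ (Set.range (C.vec b)) := top_le_span_vec C b trivial
  have hz : z ∈ Submodule.span ℂ (Set.range (C.vec b)) := top_le_span_vec C b trivial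
  induction hy using Submodule.span_induction with
  | zero => simp
  | add _ _ _ _ h h' => simp only [add_lie, map_add, h, h', add_mul, mul_add]; abel
  | smul c _ _ h => simp only [smul_lie, map_smul, h, smul_mul_assoc, mul_smul_comm, smul_sub]
  | mem y hy =>
    induction hz using Submodule.span_induction with
    | zero => simp
    | add _ _ _ _ h h' => simp only [lie_add, map_add, h, h', add_mul, mul_add]; abel
    | smul c _ _ h => simp only [lie_smul, map_smul, h, smul_mul_assoc, mul_smul_comm, smul_sub]
    | mem z hz =>
      obtain ⟨β, rfl⟩ := hy
      obtain ⟨γ, rfl⟩ := hz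
      have h := currentLin_apply X (m + m')
        ⁅(⟨C.vec b β, vec_mem_lattice C b β⟩ : C.lattice b), ⟨C.vec b γ, vec_mem_lattice C b γ⟩⁆
      have h1 := currentLin_apply X m ⟨C.vec b β, vec_mem_lattice C b β⟩
      have h2 := currentLin_apply X m' ⟨C.vec b γ, vec_mem_lattice C b γ⟩
      rw [LieSubalgebra.coe_bracket] at h
      simp only at h h1 h2
      rw [h, h1, h2, hX]
      simp [TensorProduct.tmul_sub]

lemma currentTensor_lie (hX : IsCurrentRep X) (u v : loopAlgebra ℂ M 𝔤) :
    currentTensor X ⁅u, v⁆ =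
      currentTensor X u * currentTensor X v - currentTensor X v * currentTensor X u := by
  have zero_left (w : loopAlgebra ℂ M 𝔤) :
      currentTensor X ⁅(0 : loopAlgebra ℂ M 𝔤), w⁆ = 0 :=
    (congrArg (currentTensor X) (zero_lie w)).trans (map_zero _)
  have zero_right (w : loopAlgebra ℂ M 𝔤) :
      currentTensor X ⁅w, (0 : loopAlgebra ℂ M 𝔤)⁆ = 0 :=
    (congrArg (currentTensor X) (lie_zero w)).trans (map_zero _)
  have add_left (w₁ w₂ w : loopAlgebra ℂ M 𝔤) :
      currentTensor X ⁅w₁ + w₂, w⁆ = currentTensor X ⁅w₁, w⁆ + currentTensor X ⁅w₂, w⁆ :=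
    (congrArg (currentTensor X) (add_lie w₁ w₂ w)).trans (map_add _ _ _)
  have add_right (w₁ w₂ w : loopAlgebra ℂ M 𝔤) :
      currentTensor X ⁅w, w₁ + w₂⁆ = currentTensor X ⁅w, w₁⁆ + currentTensor X ⁅w, w₂⁆ :=
    (congrArg (currentTensor X) (lie_add w w₁ w₂)).trans (map_add _ _ _)
  induction u using TensorProduct.induction_on with
  | zero => simp [zero_left]
  | add _ _ h h' => simp only [add_left, map_add, h, h', add_mul, mul_add]; abel
  | tmul f y =>
    induction v using TensorProduct.induction_on with
    | zero => simp [zero_right]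
    | add _ _ h h' => simp only [add_right, map_add, h, h', add_mul, mul_add]; abel
    | tmul g z =>
      induction f using AddMonoidAlgebra.induction_linear with
      | zero => simp [zero_left]
      | add _ _ h h' =>
        simp only [TensorProduct.add_tmul, add_left, map_add, h, h', add_mul, mul_add]; abel
      | single m c =>
        induction g using AddMonoidAlgebra.induction_linear with
        | zero => simp [zero_right]
        | add _ _ h h' =>
          simp only [TensorProduct.add_tmul, add_right, map_add, h, h', add_mul, mul_add]; abel
        | single m' c' =>
          rw [ExtendScalars.bracket_tmul, AddMonoidAlgebra.single_mul_single]
          simp only [currentTensor_single, currentLin_lie hX, smul_sub, smul_mul_smul_comm,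
            mul_comm c' c]

/-- The algebra homomorphism from the enveloping algebra of `ℂ[M] ⊗ 𝔤` to `ℂ ⊗ B` which extends the
maps `X m`. -/
def envLift (hX : IsCurrentRep X) : Env M 𝔤 →ₐ[ℂ] ℂ ⊗[ℤ] B :=
  liftOfCommutator (currentTensor X) (currentTensor_lie hX)

lemma envLift_elt (hX : IsCurrentRep X) (m : M) (y : C.lattice b) :
    envLift hX (elt m y) = 1 ⊗ₜ X m y := by
  rw [← currentLin_apply, ← one_smul ℂ (currentLin X m _), ← currentTensor_single]
  exact liftOfCommutator_ι ..

/-- Elements of the enveloping algebra of the Lie subalgebra spanned by `S` are mapped into the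
`ℂ`-span of the subring generated by the values of `X` at spanning vectors of `S`. -/
lemma envLift_mem_span (hX : IsCurrentRep X) {S : Set (loopAlgebra ℂ M 𝔤)}
    {T : Set (M × C.lattice b)} (hS : ∀ s ∈ S, s ∈ Submodule.span ℂ
      ((fun q : M × C.lattice b ↦
        (AddMonoidAlgebra.single q.1 1 ⊗ₜ[ℂ] (q.2 : 𝔤) : loopAlgebra ℂ M 𝔤)) '' T))
    (R : Subring B) (hR : ∀ q ∈ T, X q.1 q.2 ∈ R) {u : Env M 𝔤} (hu : u ∈ envelope S) :
    envLift hX u ∈ Submodule.span ℂ ((fun r : B ↦ (1 : ℂ) ⊗ₜ[ℤ] r) '' R) := by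
  induction hu using Algebra.adjoin_induction with
  | algebraMap c =>
    rw [AlgHom.commutes, Algebra.algebraMap_eq_smul_one]
    exact Submodule.smul_mem _ _ (Submodule.subset_span ⟨1, one_mem R, rfl⟩)
  | add _ _ _ _ h h' => rw [map_add]; exact add_mem h h'
  | mul _ _ _ _ h h' =>
    rw [map_mul]
    have := Submodule.mul_mem_mul h h'
    rw [Submodule.span_mul_span] at this
    refine Submodule.span_mono ?_ this
    rintro _ ⟨_, ⟨r, hr, rfl⟩, _, ⟨r', hr', rfl⟩, rfl⟩
    exact ⟨r * r', mul_mem hr hr', by simp⟩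
  | mem u hu =>
    obtain ⟨s, hs, rfl⟩ := hu
    replace hs := hS s hs
    induction hs using Submodule.span_induction with
    | zero => simp
    | add _ _ _ _ h h' => rw [map_add, map_add]; exact add_mem h h'
    | smul c _ _ h => rw [map_smul, map_smul]; exact Submodule.smul_mem _ _ h
    | mem s hs =>
      obtain ⟨q, hq, rfl⟩ := hs
      exact Submodule.subset_span ⟨X q.1 q.2, hR q hq, (envLift_elt hX q.1 q.2).symm⟩

/-- As `B` contains the divided powers of all its elements, the integral form is mapped into
`1 ⊗ B`. -/
lemma envLift_mem_range (F : Type*) [Field F] [CharZero F] [Algebra F B]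
    (hX : IsCurrentRep X) {u : Env M 𝔤} (hu : u ∈ intForm C M) :
    ∃ r : B, envLift hX u = 1 ⊗ₜ r := by
  induction hu using Algebra.adjoin_induction with
  | algebraMap c => exact ⟨algebraMap ℤ B c, by simp [← Algebra.TensorProduct.intCast_def']⟩
  | add _ _ _ _ h h' =>
    obtain ⟨r, hr⟩ := h
    obtain ⟨r', hr'⟩ := h'
    exact ⟨r + r', by rw [map_add, hr, hr', TensorProduct.tmul_add]⟩
  | mul _ _ _ _ h h' =>
    obtain ⟨r, hr⟩ := h
    obtain ⟨r', hr'⟩ := h'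
    exact ⟨r * r', by simp [hr, hr']⟩
  | mem u hu =>
    obtain ⟨α, m, k, rfl⟩ := hu
    refine ⟨(k.factorial : F)⁻¹ • X m ⟨C.x α, vec_mem_lattice C b (Sum.inl α)⟩ ^ k, ?_⟩
    have h := envLift_elt hX m ⟨C.x α, vec_mem_lattice C b (Sum.inl α)⟩
    simp only at h
    rw [dividedPower, map_smul, map_pow, h, Algebra.TensorProduct.tmul_pow, one_pow,
      inv_factorial_smul_tmul (F := F)]

/-- The universal property of the integral form over a field of characteristic zero: the maps `X m`
extend to a ring homomorphism. -/
lemma exists_ringHom_intForm (F : Type*) [Field F] [CharZero F] [Algebra F B]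
    (hX : IsCurrentRep X) :
    ∃ f : intForm C M →ₐ[ℤ] B, ∀ u : intForm C M, envLift hX (u : Env M 𝔤) = 1 ⊗ₜ f u := by
  obtain ⟨p, hp⟩ := exists_addMonoidHom_complex F
  have hr : ∀ r : B, retract B p (1 ⊗ₜ r) = r := fun r ↦ by rw [retract_tmul, hp, one_smul]
  have key : ∀ u : intForm C M,
      envLift hX (u : Env M 𝔤) = 1 ⊗ₜ retract B p (envLift hX (u : Env M 𝔤)) := by
    intro u
    obtain ⟨r, h⟩ := envLift_mem_range F hX u.2
    rw [h, hr]
  let f : intForm C M →+* B :=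
    { toFun := fun u ↦ retract B p (envLift hX (u : Env M 𝔤))
      map_zero' := by simp
      map_one' := by
        rw [OneMemClass.coe_one, map_one, Algebra.TensorProduct.one_def, hr]
      map_add' := fun u v ↦ by simp
      map_mul' := fun u v ↦ by
        rw [MulMemClass.coe_mul, map_mul, key u, key v, Algebra.TensorProduct.tmul_mul_tmul,
          one_mul, hr, hr, hr] }
  exact ⟨f.toIntAlgHom, key⟩

end Lift

end Universal

/-! ### Hyperalgebras in characteristic zero -/

section HyperLift

variable {𝔤 : Type*} [LieRing 𝔤] [LieAlgebra ℂ 𝔤] [FiniteDimensional ℂ 𝔤] [IsSimple ℂ 𝔤]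
  {𝔥 : LieSubalgebra ℂ 𝔤} [𝔥.IsCartanSubalgebra] {F : Type*} [Field F] [CharZero F]
  {C : ChevalleyBasis 𝔥} {b : (rootSystem 𝔥).Base} {M N : Type*} [AddCommMonoid M]
  [AddCommMonoid N] {B : Type*} [Ring B] [Algebra F B]

lemma enveloping_algHom_ext {L A : Type*} [LieRing L] [LieAlgebra ℂ L] [Ring A] [Algebra ℂ A]
    {f g : UniversalEnvelopingAlgebra ℂ L →ₐ[ℂ] A}
    (h : ∀ u, f (UniversalEnvelopingAlgebra.ι ℂ u) = g (UniversalEnvelopingAlgebra.ι ℂ u)) :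
    f = g :=
  UniversalEnvelopingAlgebra.hom_ext ℂ (LieHom.ext h)

lemma one_tmul_complex_injective (F : Type*) [Field F] [CharZero F] [Algebra F B] :
    Function.Injective fun r : B ↦ (1 : ℂ) ⊗ₜ[ℤ] r := by
  obtain ⟨p, hp⟩ := exists_addMonoidHom_complex F
  refine Function.LeftInverse.injective (g := retract B p) fun r ↦ ?_
  rw [retract_tmul, hp, one_smul]

lemma factorial_smul_dividedPower (α : 𝔥.root) (m : M) (k : ℕ) :
    (k.factorial : ℤ) • (⟨dividedPower (elt m (C.x α)) k, dividedPower_mem C α m k⟩ :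
      intForm C M) = ⟨elt m (C.x α), elt_x_mem C α m⟩ ^ k := by
  have hC : (k.factorial : ℂ) ≠ 0 := by exact_mod_cast k.factorial_ne_zero
  apply Subtype.ext
  simp only [SetLike.val_smul, SubmonoidClass.coe_pow, dividedPower]
  rw [← Int.cast_smul_eq_zsmul ℂ, smul_smul]
  simp [hC]

/-- Two homomorphisms from the integral form to an algebra over a field of characteristic zero are
equal if they agree on the root vectors: divided powers are determined by powers. -/
lemma intForm_algHom_ext (F : Type*) [Field F] [CharZero F] [Algebra F B]
    {f g : intForm C M →ₐ[ℤ] B}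
    (h : ∀ (α : 𝔥.root) (m : M), f ⟨elt m (C.x α), elt_x_mem C α m⟩ =
      g ⟨elt m (C.x α), elt_x_mem C α m⟩) : f = g := by
  refine AlgHom.adjoin_ext ?_
  rintro _ ⟨α, m, k, rfl⟩
  have hk : (k.factorial : F) ≠ 0 := by exact_mod_cast k.factorial_ne_zero
  have e := factorial_smul_dividedPower (C := C) α m k
  have e2 := (congrArg f e).trans (((map_pow f _ k).trans
    (congrArg (· ^ k) (h α m))).trans ((map_pow g _ k).symm.trans (congrArg g e.symm)))
  rw [map_zsmul, map_zsmul, ← Int.cast_smul_eq_zsmul F, ← Int.cast_smul_eq_zsmul F] at e2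
  exact smul_right_injective _ (by exact_mod_cast hk) e2

variable (F C b) in
/-- The element `y ⊗ t ^ m` of the hyperalgebra, for `y` in the lattice of the Chevalley basis. -/
def hyperElt (m : M) : C.lattice b →+ Hyper F C M where
  toFun y := 1 ⊗ₜ ⟨elt m y, elt_mem_intForm m y.2⟩
  map_zero' := by
    have : (⟨elt m ((0 : C.lattice b) : 𝔤), elt_mem_intForm m (0 : C.lattice b).2⟩ :
        intForm C M) = 0 := Subtype.ext ((eltHom m : 𝔤 →ₗ[ℂ] Env M 𝔤).map_zero)
    rw [this, TensorProduct.tmul_zero]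
  map_add' y z := by
    rw [← TensorProduct.tmul_add]
    congr 1
    exact Subtype.ext ((eltHom m : 𝔤 →ₗ[ℂ] Env M 𝔤).map_add y z)

omit [CharZero F] in
lemma hyperElt_apply (m : M) (y : C.lattice b) :
    hyperElt F C b m y = 1 ⊗ₜ ⟨elt m y, elt_mem_intForm m y.2⟩ := rfl

variable (F C b M) in
omit [CharZero F] in
lemma isCurrentRep_hyperElt : IsCurrentRep (hyperElt F C b (M := M)) := by
  intro m m' y z
  simp only [hyperElt_apply, Algebra.TensorProduct.tmul_mul_tmul, one_mul]
  rw [← TensorProduct.tmul_sub]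
  congr 1
  exact Subtype.ext (elt_lie m m' (y : 𝔤) z)

variable {X : M → C.lattice b →+ B}

/-- The ring homomorphism from the integral form which extends the maps `X m`
(see `one_tmul_intLift`). -/
def intLift (F : Type*) [Field F] [CharZero F] [Algebra F B] (hX : IsCurrentRep X) :
    intForm C M →ₐ[ℤ] B :=
  (exists_ringHom_intForm F hX).choose

lemma one_tmul_intLift (hX : IsCurrentRep X) (u : intForm C M) :
    1 ⊗ₜ intLift F hX u = envLift hX (u : Env M 𝔤) :=
  ((exists_ringHom_intForm F hX).choose_spec u).symm

/-- The algebra homomorphism from the hyperalgebra which extends the maps `X m`. -/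
def hyperLift (F : Type*) [Field F] [CharZero F] [Algebra F B] (hX : IsCurrentRep X) :
    Hyper F C M →ₐ[F] B :=
  Algebra.TensorProduct.lift (Algebra.ofId F B) (intLift F hX) fun c _ ↦ Algebra.commutes c _

lemma hyperLift_one_tmul (hX : IsCurrentRep X) (u : intForm C M) :
    hyperLift F hX (1 ⊗ₜ u) = intLift F hX u :=
  (Algebra.TensorProduct.lift_tmul ..).trans (by rw [map_one, one_mul])

lemma hyperLift_hyperElt (hX : IsCurrentRep X) (m : M) (y : C.lattice b) :
    hyperLift F hX (hyperElt F C b m y) = X m y := by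
  apply one_tmul_complex_injective F
  simp only
  rw [hyperElt_apply, hyperLift_one_tmul, one_tmul_intLift, envLift_elt]

variable (C b) in
/-- The root vector `x_α` as an element of the Chevalley lattice. -/
def rootVec (α : 𝔥.root) : C.lattice b := ⟨C.x α, vec_mem_lattice C b (Sum.inl α)⟩

variable (C b) in
/-- The coroot `h_α` as an element of the Chevalley lattice. -/
def corootVec (α : 𝔥.root) : C.lattice b := ⟨(coroot α.1 : 𝔤), coroot_mem_lattice C b α⟩

variable (b) in
lemma divPow_eq (α : 𝔥.root) (m : M) (k : ℕ) :
    divPow F C α m k = (k.factorial : F)⁻¹ • hyperElt F C b m (rootVec C b α) ^ k := by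
  have hk : (k.factorial : F) ≠ 0 := by exact_mod_cast k.factorial_ne_zero
  have h : hyperElt F C b m (rootVec C b α) ^ k = (k.factorial : F) • divPow F C α m k := by
    rw [hyperElt_apply, Algebra.TensorProduct.tmul_pow, one_pow, divPow, ← Int.cast_natCast,
      Int.cast_smul_eq_zsmul, ← TensorProduct.tmul_smul, factorial_smul_dividedPower]
    rfl
  rw [h, smul_smul, inv_mul_cancel₀ hk, one_smul]

variable (b) in
/-- In characteristic zero, homomorphisms from the hyperalgebra are determined by their values at the
`x_α ⊗ t ^ m`. -/
lemma hyper_algHom_ext {f g : Hyper F C M →ₐ[F] B}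
    (h : ∀ (α : 𝔥.root) (m : M), f (hyperElt F C b m (rootVec C b α)) =
      g (hyperElt F C b m (rootVec C b α))) : f = g := by
  refine Algebra.TensorProduct.ext (by ext) ?_
  exact intForm_algHom_ext F h

variable (F C b M) in
/-- In characteristic zero the hyperalgebra is generated by the `x_α ⊗ t ^ m`. -/
lemma adjoin_rootVec_eq_top : Algebra.adjoin F
    {z | ∃ (α : 𝔥.root) (m : M), z = hyperElt F C b m (rootVec C b α)} = ⊤ := by
  set A := Algebra.adjoin F {z | ∃ (α : 𝔥.root) (m : M), z = hyperElt F C b m (rootVec C b α)}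
    with hA
  rw [eq_top_iff]
  rintro z -
  induction z using TensorProduct.induction_on with
  | zero => exact zero_mem _
  | add _ _ h h' => exact add_mem h h'
  | tmul c u =>
    have e : (c ⊗ₜ u : Hyper F C M) = c • (1 ⊗ₜ u) := by
      rw [TensorProduct.smul_tmul', smul_eq_mul, mul_one]
    refine e ▸ Subalgebra.smul_mem _ ?_ c
    clear e
    obtain ⟨u, hu⟩ := u
    have hu' := hu
    unfold intForm at hu'
    induction hu' using Algebra.adjoin_induction with
    | algebraMap k =>
      have : (1 ⊗ₜ ⟨algebraMap ℤ (Env M 𝔤) k, hu⟩ : Hyper F C M) = algebraMap ℤ _ k := by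
        rw [eq_intCast (algebraMap ℤ (Hyper F C M)) k, Algebra.TensorProduct.intCast_def']
        rfl
      rw [this, eq_intCast]
      exact intCast_mem _ k
    | add x y hx hy h h' =>
      have := add_mem (h hx) (h' hy)
      rwa [← TensorProduct.tmul_add] at this
    | mul x y hx hy h h' =>
      have := mul_mem (h hx) (h' hy)
      rwa [Algebra.TensorProduct.tmul_mul_tmul, one_mul] at this
    | mem x hx =>
      obtain ⟨α, m, k, rfl⟩ := hx
      have h := A.smul_mem (pow_mem (Algebra.subset_adjoin ⟨α, m, rfl⟩ : _ ∈ A) k)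
        (k.factorial : F)⁻¹
      rw [← divPow_eq] at h
      exact h

/-- In characteristic zero, the image of the hyperalgebra of the Lie subalgebra spanned by `S` lies in
the algebra generated by any set of elements `y ⊗ t ^ m`, with `y` in the Chevalley lattice, whose
complex span contains `S`. -/
lemma one_tmul_mem_adjoin {S : Set (loopAlgebra ℂ M 𝔤)}
    {T : Set (M × C.lattice b)} (hS : ∀ s ∈ S, s ∈ Submodule.span ℂ
      ((fun q : M × C.lattice b ↦
        (AddMonoidAlgebra.single q.1 1 ⊗ₜ[ℂ] (q.2 : 𝔤) : loopAlgebra ℂ M 𝔤)) '' T))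
    (u : intForm C M) (hu : (u : Env M 𝔤) ∈ envelope S) :
    (1 ⊗ₜ u : Hyper F C M) ∈
      Algebra.adjoin F ((fun q : M × C.lattice b ↦ hyperElt F C b q.1 q.2) '' T) := by
  set A := Algebra.adjoin F ((fun q : M × C.lattice b ↦ hyperElt F C b q.1 q.2) '' T) with hA
  have hX := isCurrentRep_hyperElt F C b M
  have h1 := envLift_mem_span hX hS A.toSubring
    (fun q hq ↦ Algebra.subset_adjoin ⟨q, hq, rfl⟩) hu
  have h2 : intLift F hX = Algebra.TensorProduct.includeRight := by
    refine intForm_algHom_ext F fun α m ↦ ?_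
    rw [← hyperLift_one_tmul]
    exact hyperLift_hyperElt hX m (rootVec C b α)
  obtain ⟨p, hp⟩ := exists_addMonoidHom_complex F
  have h3 : ∀ z ∈ Submodule.span ℂ ((fun r : Hyper F C M ↦ (1 : ℂ) ⊗ₜ[ℤ] r) '' A.toSubring),
      retract _ p z ∈ A := by
    intro z hz
    induction hz using Submodule.closure_induction with
    | zero => rw [LinearMap.map_zero]; exact zero_mem A
    | add _ _ _ _ h h' => rw [LinearMap.map_add]; exact add_mem h h'
    | smul_mem c z hz =>
      obtain ⟨r, hr, rfl⟩ := hz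
      simp only
      rw [TensorProduct.smul_tmul', retract_tmul]
      exact A.smul_mem hr _
  have h4 := h3 _ h1
  rw [← one_tmul_intLift (F := F), retract_tmul, hp, one_smul, h2] at h4
  exact h4

/-- The homomorphism extending the zero maps, which is the counit of the hyperalgebra, kills the
elements of the integral form whose complex counit is zero. -/
lemma hyperLift_zero_one_tmul (hX : IsCurrentRep (fun _ ↦ 0 : M → C.lattice b →+ F))
    (u : intForm C M) (hu : counit M 𝔤 u = 0) : hyperLift F hX (1 ⊗ₜ u) = 0 := by
  have h : envLift hX = (Algebra.ofId ℂ (ℂ ⊗[ℤ] F)).comp (counit M 𝔤) := by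
    refine enveloping_algHom_ext fun x ↦ ?_
    have h1 : currentTensor (fun _ ↦ 0 : M → C.lattice b →+ F) x = 0 := by
      induction x using TensorProduct.induction_on with
      | zero => simp
      | add _ _ h h' => rw [map_add, h, h', add_zero]
      | tmul f y =>
        induction f using AddMonoidAlgebra.induction_linear with
        | zero => simp
        | add _ _ h h' => rw [TensorProduct.add_tmul, map_add, h, h', add_zero]
        | single m c =>
          rw [currentTensor_single]
          have : currentLin (fun _ ↦ 0 : M → C.lattice b →+ F) m = 0 :=
            (C.basis b).ext fun β ↦ by simp [currentLin]
          rw [this, LinearMap.zero_apply, smul_zero]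
    have h2 : counit M 𝔤 (UniversalEnvelopingAlgebra.ι ℂ x) = 0 :=
      UniversalEnvelopingAlgebra.lift_ι_apply ..
    have h3 := liftOfCommutator_ι (currentTensor (fun _ ↦ 0 : M → C.lattice b →+ F))
      (currentTensor_lie hX) x
    rw [AlgHom.comp_apply]
    rw [h2, map_zero, ← h1, ← h3]
    rfl
  apply one_tmul_complex_injective F
  simp only
  rw [hyperLift_one_tmul, one_tmul_intLift, h]
  simp [hu]

end HyperLift

section Current

variable {𝔤 : Type*} [LieRing 𝔤] [LieAlgebra ℂ 𝔤] [FiniteDimensional ℂ 𝔤] [IsSimple ℂ 𝔤]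
  {𝔥 : LieSubalgebra ℂ 𝔤} [𝔥.IsCartanSubalgebra] {F : Type*} [Field F]
  {C : ChevalleyBasis 𝔥} {b : (rootSystem 𝔥).Base} {M N P : Type*} [AddCommMonoid M]
  [AddCommMonoid N] [AddCommMonoid P]

variable (F C b M) in
/-- The element `y ⊗ f` of the hyperalgebra, for `y` in the lattice of the Chevalley basis and
`f ∈ F[M]`. -/
def cur : C.lattice b →+ AddMonoidAlgebra F M →ₗ[F] Hyper F C M where
  toFun y := Finsupp.linearCombination F (fun m ↦ hyperElt F C b m y) ∘ₗ
    (AddMonoidAlgebra.coeffLinearEquiv F).toLinearMap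
  map_zero' := by ext; simp
  map_add' y z := by ext; simp

lemma cur_single (y : C.lattice b) (m : M) (c : F) :
    cur F C b M y (AddMonoidAlgebra.single m c) = c • hyperElt F C b m y := by
  simp [cur]

lemma cur_lie (y z : C.lattice b) (f g : AddMonoidAlgebra F M) :
    cur F C b M ⁅y, z⁆ (f * g) =
      cur F C b M y f * cur F C b M z g - cur F C b M z g * cur F C b M y f := by
  induction f using AddMonoidAlgebra.induction_linear with
  | zero => simp
  | add _ _ h h' => simp only [map_add, h, h', add_mul, mul_add]; abel
  | single m c =>
    induction g using AddMonoidAlgebra.induction_linear with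
    | zero => simp
    | add _ _ h h' => simp only [map_add, h, h', add_mul, mul_add]; abel
    | single m' c' =>
      rw [AddMonoidAlgebra.single_mul_single]
      simp only [cur_single, isCurrentRep_hyperElt F C b M m m' y z, smul_sub, smul_mul_smul_comm,
        mul_comm c' c]

lemma isCurrentRep_cur (σ : AddMonoidAlgebra F M →ₐ[F] AddMonoidAlgebra F N) :
    IsCurrentRep (fun m ↦ (LinearMap.applyₗ (σ (AddMonoidAlgebra.single m 1))).toAddMonoidHom.comp
      (cur F C b N) : M → C.lattice b →+ Hyper F C N) := by
  intro m m' y z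
  have h : σ (AddMonoidAlgebra.single (m + m') 1) =
      σ (AddMonoidAlgebra.single m 1) * σ (AddMonoidAlgebra.single m' 1) := by
    rw [← map_mul, AddMonoidAlgebra.single_mul_single, one_mul]
  change cur F C b N ⁅y, z⁆ (σ (AddMonoidAlgebra.single (m + m') 1)) = _
  rw [h, cur_lie]
  rfl

variable [CharZero F]

variable (C b) in
/-- The homomorphism of hyperalgebras `y ⊗ f ↦ y ⊗ σ f` induced by a homomorphism `σ` of coefficient
algebras. -/
def hyperMap (σ : AddMonoidAlgebra F M →ₐ[F] AddMonoidAlgebra F N) : Hyper F C M →ₐ[F] Hyper F C N :=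
  hyperLift F (isCurrentRep_cur (C := C) (b := b) σ)

lemma hyperMap_cur (σ : AddMonoidAlgebra F M →ₐ[F] AddMonoidAlgebra F N) (y : C.lattice b)
    (f : AddMonoidAlgebra F M) : hyperMap C b σ (cur F C b M y f) = cur F C b N y (σ f) := by
  induction f using AddMonoidAlgebra.induction_linear with
  | zero => simp
  | add _ _ h h' => simp only [map_add, h, h']
  | single m c =>
    have h : AddMonoidAlgebra.single m c = c • AddMonoidAlgebra.single m (1 : F) := by simp
    rw [h, map_smul, map_smul, map_smul, map_smul, cur_single, one_smul, hyperMap,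
      hyperLift_hyperElt]
    rfl

lemma hyperMap_hyperElt (σ : AddMonoidAlgebra F M →ₐ[F] AddMonoidAlgebra F N) (m : M)
    (y : C.lattice b) : hyperMap C b σ (hyperElt F C b m y) =
      cur F C b N y (σ (AddMonoidAlgebra.single m 1)) := by
  rw [← hyperMap_cur, cur_single, one_smul]

lemma hyperMap_comp (σ : AddMonoidAlgebra F M →ₐ[F] AddMonoidAlgebra F N)
    (τ : AddMonoidAlgebra F N →ₐ[F] AddMonoidAlgebra F P) :
    (hyperMap C b τ).comp (hyperMap C b σ) = hyperMap C b (τ.comp σ) := by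
  refine hyper_algHom_ext b fun α m ↦ ?_
  rw [AlgHom.comp_apply, hyperMap_hyperElt, hyperMap_hyperElt, hyperMap_cur]
  rfl

lemma hyperMap_id : hyperMap C b (AlgHom.id F (AddMonoidAlgebra F M)) = AlgHom.id F _ := by
  refine hyper_algHom_ext b fun α m ↦ ?_
  rw [hyperMap_hyperElt, AlgHom.id_apply, cur_single, one_smul]
  rfl

end Current

/-! ### The shift automorphism and the restriction map -/

section Shift

variable {𝔤 : Type*} [LieRing 𝔤] [LieAlgebra ℂ 𝔤] [FiniteDimensional ℂ 𝔤] [IsSimple ℂ 𝔤]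
  {𝔥 : LieSubalgebra ℂ 𝔤} [𝔥.IsCartanSubalgebra] {F : Type*} [Field F]
  {C : ChevalleyBasis 𝔥} {b : (rootSystem 𝔥).Base} {n : ℕ}

/-- The translation `f(t) ↦ f(t - a)` of the polynomial ring. -/
def translate (a : Fin n → F) : MvPolynomial (Fin n) F →ₐ[F] MvPolynomial (Fin n) F :=
  MvPolynomial.aeval fun j ↦ MvPolynomial.X j - MvPolynomial.C (a j)

lemma translate_comp_neg (a : Fin n → F) :
    (translate a).comp (translate (-a)) = AlgHom.id F _ := by
  ext j
  simp [translate]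

lemma currentElt_eq_cur (y : 𝔥.root ⊕ b.support) (f : MvPolynomial (Fin n) F) :
    currentElt F C b y f = cur F C b _ ⟨C.vec b y, vec_mem_lattice C b y⟩ f := by
  have h : ∀ (c : F) (s : Fin n →₀ ℕ), (c ⊗ₜ ⟨elt s (C.vec b y), elt_vec_mem C b y s⟩ :
      Hyper F C (Fin n →₀ ℕ)) = c • hyperElt F C b s ⟨C.vec b y, vec_mem_lattice C b y⟩ := by
    intro c s
    rw [hyperElt_apply, TensorProduct.smul_tmul', smul_eq_mul, mul_one]
  simp only [currentElt, h]
  rfl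

variable [CharZero F]

variable (C b) in
/-- The automorphism `y ⊗ f(t) ↦ y ⊗ f(t - a)` of the hyperalgebra of `𝔤[n]`. -/
def shiftEquiv (a : Fin n → F) : Hyper F C (Fin n →₀ ℕ) ≃ₐ[F] Hyper F C (Fin n →₀ ℕ) :=
  AlgEquiv.ofAlgHom (hyperMap C b (translate a)) (hyperMap C b (translate (-a)))
    (by rw [hyperMap_comp, translate_comp_neg, hyperMap_id])
    (by
      have h := translate_comp_neg (-a)
      rw [neg_neg] at h
      rw [hyperMap_comp, h, hyperMap_id])

lemma shiftEquiv_cur (a : Fin n → F) (y : C.lattice b) (f : MvPolynomial (Fin n) F) :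
    shiftEquiv C b a (cur F C b _ y f) = cur F C b _ y (translate a f) :=
  hyperMap_cur _ y f

lemma isShift_shiftEquiv (a : Fin n → F) : IsShift F C b a (shiftEquiv C b a) := by
  intro y f
  rw [currentElt_eq_cur, currentElt_eq_cur, shiftEquiv_cur]
  rfl

/-- The inclusion of the polynomials in the Laurent polynomials. -/
def toLaurent (F : Type*) [Field F] (n : ℕ) :
    MvPolynomial (Fin n) F →ₐ[F] AddMonoidAlgebra F (Fin n →₀ ℤ) :=
  AddMonoidAlgebra.mapDomainAlgHom F F
    (Finsupp.mapRange.addMonoidHom (Nat.castAddMonoidHom ℤ) : (Fin n →₀ ℕ) →+ (Fin n →₀ ℤ))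

variable (b) in
lemma currentToLoop_eq_hyperMap : currentToLoop F C n = hyperMap C b (toLaurent F n) := by
  refine hyper_algHom_ext b fun α m ↦ ?_
  rw [hyperMap_hyperElt]
  have h : toLaurent F n (AddMonoidAlgebra.single m 1) = AddMonoidAlgebra.single
      (Finsupp.mapRange.addMonoidHom (Nat.castAddMonoidHom ℤ) m) 1 := by
    simp [toLaurent]
  rw [h, cur_single, one_smul, hyperElt_apply, hyperElt_apply, currentToLoop]
  refine (Algebra.TensorProduct.map_tmul ..).trans ?_
  rw [map_one]
  congr 1
  exact Subtype.ext (envMap_elt ..)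

lemma currentToLoop_cur (y : C.lattice b) (f : MvPolynomial (Fin n) F) :
    currentToLoop F C n (cur F C b _ y f) = cur F C b _ y (toLaurent F n f) := by
  rw [currentToLoop_eq_hyperMap b, hyperMap_cur]

end Shift

/-! ### Highest weight vectors for `𝔰𝔩₂ ⊗ A` -/

section SlTwo

variable {F A H V : Type*} [Field F] [CommRing A] [Algebra F A] [Ring H] [Algebra F H]
  [AddCommGroup V] [Module F V] [Module H V] [IsScalarTower F H V]

/-- Linear maps `E`, `G`, `K` from a commutative algebra `A` to an associative algebra which satisfy
the relations of `x⁺ ⊗ f`, `x⁻ ⊗ f`, `h ⊗ f` in `𝔰𝔩₂ ⊗ A` that are needed for the action on a highest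
weight vector. -/
structure IsSlTwoCurrent (E G K : A →ₗ[F] H) : Prop where
  e_mul_g : ∀ f g, E f * G g = G g * E f + K (f * g)
  k_mul_g : ∀ f g, K f * G g = G g * K f - (2 : F) • G (f * g)
  g_comm : ∀ f g, G f * G g = G g * G f

variable {E G K : A →ₗ[F] H}

/-- `IsMonomial G f w k d v c` says that `v` is a linear combination, with coefficients adding up
to `c`, of vectors `G (f ^ i₁) ⋯ G (f ^ iₖ) w` with `i₁ + ⋯ + iₖ = d`. -/
inductive IsMonomial (G : A →ₗ[F] H) (f : A) (w : V) : ℕ → ℕ → V → F → Prop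
  | base : IsMonomial G f w 0 0 w 1
  | zero (k d : ℕ) : IsMonomial G f w k d 0 0
  | add {k d : ℕ} {v v' : V} {c c' : F} : IsMonomial G f w k d v c → IsMonomial G f w k d v' c' →
      IsMonomial G f w k d (v + v') (c + c')
  | smul (r : F) {k d : ℕ} {v : V} {c : F} : IsMonomial G f w k d v c →
      IsMonomial G f w k d (r • v) (r * c)
  | cons (i : ℕ) {k d : ℕ} {v : V} {c : F} : IsMonomial G f w k d v c →
      IsMonomial G f w (k + 1) (d + i) (G (f ^ i) • v) c

namespace IsMonomial

variable {f : A} {w : V}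

omit [IsScalarTower F H V] in
/-- A combination of empty products is a multiple of `w`, and is zero unless `d = 0`. -/
lemma eq_smul_of_zero {k d : ℕ} {v : V} {c : F} (h : IsMonomial G f w k d v c) (hk : k = 0) :
    v = c • w ∧ (d = 0 ∨ c = 0) := by
  induction h with
  | base => simp
  | zero => simp
  | add _ _ h h' =>
    obtain ⟨rfl, h1⟩ := h hk
    obtain ⟨rfl, h2⟩ := h' hk
    refine ⟨(add_smul _ _ _).symm, ?_⟩
    rcases h1 with h1 | h1 <;> rcases h2 with h2 | h2 <;> simp [h1, h2]
  | smul r _ h =>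
    obtain ⟨rfl, h1⟩ := h hk
    refine ⟨smul_smul _ _ _, ?_⟩
    rcases h1 with h1 | h1 <;> simp [h1]
  | cons => omega

lemma eq_smul_of_one {k d : ℕ} {v : V} {c : F} (h : IsMonomial G f w k d v c) (hk : k = 1) :
    v = c • G (f ^ d) • w := by
  induction h with
  | base => omega
  | zero => simp
  | add _ _ h h' => rw [h hk, h' hk, add_smul]
  | smul r _ h => rw [h hk, smul_smul]
  | cons i h _ =>
    obtain ⟨rfl, h1⟩ := h.eq_smul_of_zero (by omega)
    rcases h1 with rfl | rfl
    · rw [zero_add, smul_comm]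
    · simp

/-- As `h ⊗ f ^ (s + 1)` kills `w`, its action is a sum over the `k` factors; the commutator turns the
factor `x⁻ ⊗ f ^ i` into `-2 x⁻ ⊗ f ^ (i + s + 1)`. -/
lemma smul_k (hs : IsSlTwoCurrent E G K) (hw : ∀ s, K (f ^ (s + 1)) • w = 0) (s : ℕ)
    {k d : ℕ} {v : V} {c : F} (h : IsMonomial G f w k d v c) :
    IsMonomial G f w k (d + (s + 1)) (K (f ^ (s + 1)) • v) (-2 * k * c) := by
  induction h with
  | base => simpa [hw] using IsMonomial.zero _ _
  | zero => simpa using IsMonomial.zero _ _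
  | add _ _ h h' => rw [smul_add, mul_add]; exact h.add h'
  | smul r _ h => rw [smul_comm, mul_left_comm]; exact h.smul r
  | @cons i k d v c h ih =>
    rw [← mul_smul, hs.k_mul_g, sub_smul, mul_smul, smul_assoc, ← pow_add]
    have h1 := ih.cons i
    have h2 := (h.cons (s + 1 + i)).smul (-2)
    have e1 : d + (s + 1) + i = d + i + (s + 1) := by ring
    have e2 : d + (s + 1 + i) = d + i + (s + 1) := by ring
    rw [e1] at h1
    rw [e2] at h2
    convert h1.add h2 using 1
    · rw [neg_smul, sub_eq_add_neg]
    · push_cast; ring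

/-- Applying `x⁺ ⊗ f` replaces two of the `k` factors by one, each of the `k (k - 1) / 2` pairs
contributing with coefficient `-2`, and raises the total exponent by one. -/
lemma smul_e (hs : IsSlTwoCurrent E G K) (he : E f • w = 0) (hw : ∀ s, K (f ^ (s + 1)) • w = 0)
    {k d : ℕ} {v : V} {c : F} (h : IsMonomial G f w k d v c) {j : ℕ} (hj : k = j + 1) :
    IsMonomial G f w j (d + 1) (E f • v) (-(j + 1) * j * c) := by
  induction h generalizing j with
  | base => omega
  | zero => simpa using IsMonomial.zero _ _
  | add _ _ h h' => rw [smul_add, mul_add]; exact (h hj).add (h' hj)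
  | smul r _ h => rw [smul_comm, mul_left_comm]; exact (h hj).smul r
  | @cons i k d v c h ih =>
    obtain rfl : k = j := by omega
    rw [← mul_smul, hs.e_mul_g, add_smul, mul_smul, ← pow_succ']
    have h2 := h.smul_k hs hw i
    rw [← add_assoc] at h2
    rcases k with _ | k
    · obtain ⟨rfl, -⟩ := h.eq_smul_of_zero rfl
      rw [smul_comm (E f) c w, he]
      simpa using h2
    · have h1 := (ih rfl).cons i
      rw [add_right_comm] at h1
      convert h1.add h2 using 1
      push_cast; ring

end IsMonomial

/-- If `w` is a highest weight vector with `h ⊗ f ^ s` acting by zero on it for `s > 0`, then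
applying `N` times `x⁺ ⊗ f` to `(x⁻) ^ (N + 1) w` gives a nonzero multiple of `(x⁻ ⊗ f ^ N) w`. -/
lemma g_pow_smul_eq_zero [CharZero F] (hs : IsSlTwoCurrent E G K) {f : A} {w : V}
    (he : E f • w = 0) (hw : ∀ s, K (f ^ (s + 1)) • w = 0) {N : ℕ}
    (hN : G 1 ^ (N + 1) • w = 0) : G (f ^ N) • w = 0 := by
  have h1 : ∀ k, IsMonomial G f w k 0 (G 1 ^ k • w) 1 := by
    intro k
    induction k with
    | zero => simpa using IsMonomial.base
    | succ k ih =>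
      have := ih.cons 0
      rwa [pow_zero, ← mul_smul, ← pow_succ'] at this
  have h2 : ∀ j k, j + k = N + 1 → 0 < k → ∃ c : F, c ≠ 0 ∧
      IsMonomial G f w k j (E f ^ j • G 1 ^ (N + 1) • w) c := by
    intro j
    induction j with
    | zero =>
      intro k hk _
      obtain rfl : k = N + 1 := by omega
      exact ⟨1, one_ne_zero, by simpa using h1 (N + 1)⟩
    | succ j ih =>
      intro k hk hk0
      obtain ⟨c, hc, h⟩ := ih (k + 1) (by omega) (by omega)
      refine ⟨_, ?_, by
        have := h.smul_e hs he hw rfl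
        rwa [← mul_smul, ← pow_succ'] at this⟩
      have : (k : F) ≠ 0 := by exact_mod_cast hk0.ne'
      have h' : (k : F) + 1 ≠ 0 := by exact_mod_cast Nat.succ_ne_zero k
      exact mul_ne_zero (mul_ne_zero (neg_ne_zero.mpr h') this) hc
  obtain ⟨c, hc, h⟩ := h2 N 1 rfl one_pos
  have h3 := h.eq_smul_of_one rfl
  rw [hN, smul_zero] at h3
  exact (smul_eq_zero.mp h3.symm).resolve_left hc

/-- The commutator with `h ⊗ g` carries `x⁻ ⊗ f` to a multiple of `x⁻ ⊗ f g`. -/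
lemma g_mul_smul_eq_zero [CharZero F] (hs : IsSlTwoCurrent E G K) {w : V}
    (hK : ∀ g, ∃ c : F, K g • w = c • w) {f : A} (hf : G f • w = 0) (g : A) :
    G (f * g) • w = 0 := by
  have h : K g • G f • w = 0 := by rw [hf, smul_zero]
  obtain ⟨c, hc⟩ := hK g
  rw [← mul_smul, hs.k_mul_g, sub_smul, mul_smul, hc, smul_comm, hf, smul_zero, zero_sub,
    neg_eq_zero, smul_assoc, mul_comm g f] at h
  exact (smul_eq_zero.mp h).resolve_left two_ne_zero

omit [Module F V] [IsScalarTower F H V] in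
lemma k_smul_eq_zero (hs : IsSlTwoCurrent E G K) {w : V} (he : ∀ f, E f • w = 0) {f : A}
    (hf : G f • w = 0) : K f • w = 0 := by
  have h : E 1 • G f • w = 0 := by rw [hf, smul_zero]
  rwa [← mul_smul, hs.e_mul_g, add_smul, mul_smul, he, smul_zero, zero_add, one_mul] at h

/-- `IsWord G u w k d v` says that `v` is a linear combination of vectors
`G (u ^ i₁) ⋯ G (u ^ iₖ) w`, in each of which some exponent is positive if `d = true`. -/
inductive IsWord (G : A →ₗ[F] H) (u : A) (w : V) : ℕ → Bool → V → Prop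
  | base : IsWord G u w 0 false w
  | zero (k : ℕ) (d : Bool) : IsWord G u w k d 0
  | add {k : ℕ} {d : Bool} {v v' : V} : IsWord G u w k d v → IsWord G u w k d v' →
      IsWord G u w k d (v + v')
  | smul (r : F) {k : ℕ} {d : Bool} {v : V} : IsWord G u w k d v → IsWord G u w k d (r • v)
  | cons (i : ℕ) {k : ℕ} {d : Bool} {v : V} : IsWord G u w k d v →
      IsWord G u w (k + 1) d (G (u ^ i) • v)
  | mark (i : ℕ) {k : ℕ} {v : V} : IsWord G u w k false v →
      IsWord G u w (k + 1) true (G (u ^ (i + 1)) • v)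

namespace IsWord

variable {u : A} {w : V}

omit [IsScalarTower F H V] in
lemma forget {k : ℕ} {d : Bool} {v : V} (h : IsWord G u w k d v) : IsWord G u w k false v := by
  induction h with
  | base => exact base
  | zero => exact zero _ _
  | add _ _ h h' => exact h.add h'
  | smul r _ h => exact h.smul r
  | cons i _ h => exact h.cons i
  | mark i h _ => exact h.cons _

omit [IsScalarTower F H V] in
lemma of_true {k : ℕ} {v : V} (d : Bool) (h : IsWord G u w k true v) : IsWord G u w k d v := by
  cases d
  · exact h.forget
  · exact h

omit [IsScalarTower F H V] in
lemma eq_zero {k : ℕ} {d : Bool} {v : V} (h : IsWord G u w k d v) (hk : k = 0)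
    (hd : d = true) : v = 0 := by
  induction h with
  | base => simp at hd
  | zero => rfl
  | add _ _ h h' => rw [h hk hd, h' hk hd, add_zero]
  | smul r _ h => rw [h hk hd, smul_zero]
  | cons => omega
  | mark => omega

lemma e_smul_eq_zero (he : E u • w = 0) {k : ℕ} {d : Bool} {v : V} (h : IsWord G u w k d v)
    (hk : k = 0) : E u • v = 0 := by
  induction h with
  | base => exact he
  | zero => exact smul_zero _
  | add _ _ h h' => rw [smul_add, h hk, h' hk, add_zero]
  | smul r _ h => rw [smul_comm, h hk, smul_zero]
  | cons => omega
  | mark => omega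

omit [IsScalarTower F H V] in
lemma sub_two_smul {k : ℕ} {d : Bool} {v v' : V} (h : IsWord G u w k d v)
    (h' : IsWord G u w k d v') : IsWord G u w k d (v - (2 : F) • v') := by
  have := h.add (h'.smul (-2))
  rwa [neg_smul, ← sub_eq_add_neg] at this

/-- An operator `h ⊗ u ^ (s + 2)` kills `w`, so that it has to raise the exponent of a factor. -/
lemma smul_k_pow (hs : IsSlTwoCurrent E G K) (hw : ∀ s, K (u ^ (s + 2)) • w = 0) (s : ℕ)
    {k : ℕ} {d : Bool} {v : V} (h : IsWord G u w k d v) :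
    IsWord G u w k true (K (u ^ (s + 2)) • v) := by
  induction h with
  | base => rw [hw]; exact zero _ _
  | zero => rw [smul_zero]; exact zero _ _
  | add _ _ h h' => rw [smul_add]; exact h.add h'
  | smul r _ h => rw [smul_comm]; exact h.smul r
  | cons i h ih =>
    rw [← mul_smul, hs.k_mul_g, sub_smul, mul_smul, smul_assoc, ← pow_add, add_right_comm s 2 i]
    exact (ih.cons i).sub_two_smul (h.forget.mark (s + i + 1))
  | mark i h ih =>
    rw [← mul_smul, hs.k_mul_g, sub_smul, mul_smul, smul_assoc, ← pow_add, ← add_assoc]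
    exact (ih.cons _).sub_two_smul (h.mark (s + 2 + i))

lemma smul_k (hs : IsSlTwoCurrent E G K) {c : F} (hw : K u • w = c • w)
    {k : ℕ} {d : Bool} {v : V} (h : IsWord G u w k d v) :
    IsWord G u w k d (K u • v) := by
  induction h with
  | base => rw [hw]; exact base.smul c
  | zero => rw [smul_zero]; exact zero _ _
  | add _ _ h h' => rw [smul_add]; exact h.add h'
  | smul r _ h => rw [smul_comm]; exact h.smul r
  | cons i h ih =>
    rw [← mul_smul, hs.k_mul_g, sub_smul, mul_smul, smul_assoc, ← pow_succ']
    exact (ih.cons i).sub_two_smul (h.cons (i + 1))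
  | mark i h ih =>
    rw [← mul_smul, hs.k_mul_g, sub_smul, mul_smul, smul_assoc, ← pow_succ']
    exact (ih.mark i).sub_two_smul (h.mark (i + 1))

lemma smul_e (hs : IsSlTwoCurrent E G K) (he : E u • w = 0) {c : F} (hw : K u • w = c • w)
    (hw' : ∀ s, K (u ^ (s + 2)) • w = 0) {k : ℕ} {d : Bool} {v : V} (h : IsWord G u w k d v)
    {j : ℕ} (hj : k = j + 1) : IsWord G u w j d (E u • v) := by
  induction h generalizing j with
  | base => omega
  | zero => rw [smul_zero]; exact zero _ _
  | add _ _ h h' => rw [smul_add]; exact (h hj).add (h' hj)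
  | smul r _ h => rw [smul_comm]; exact (h hj).smul r
  | @cons i k d v h ih =>
    obtain rfl : k = j := by omega
    rw [← mul_smul, hs.e_mul_g, add_smul, mul_smul, ← pow_succ']
    refine add ?_ ?_
    · rcases k with _ | k
      · rw [h.e_smul_eq_zero he rfl, smul_zero]
        exact zero _ _
      · exact (ih rfl).cons i
    · rcases i with _ | i
      · rw [zero_add, pow_one]
        exact h.smul_k hs hw
      · exact (h.smul_k_pow hs hw' i).of_true d
  | @mark i k v h ih =>
    obtain rfl : k = j := by omega
    rw [← mul_smul, hs.e_mul_g, add_smul, mul_smul, ← pow_succ']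
    refine add ?_ (h.smul_k_pow hs hw' i)
    rcases k with _ | k
    · rw [h.e_smul_eq_zero he rfl, smul_zero]
      exact zero _ _
    · exact (ih rfl).mark i

/-- Each application of `x⁺ ⊗ u` shortens the products by one factor and keeps a positive exponent
in them, which is impossible for the empty product. -/
lemma e_pow_smul_eq_zero (hs : IsSlTwoCurrent E G K) (he : E u • w = 0) {c : F}
    (hw : K u • w = c • w) (hw' : ∀ s, K (u ^ (s + 2)) • w = 0) {k : ℕ} {v : V}
    (h : IsWord G u w k true v) : E u ^ k • v = 0 := by
  induction k generalizing v with
  | zero => rw [h.eq_zero rfl rfl, smul_zero]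
  | succ k ih => rw [pow_succ, mul_smul, ih (h.smul_e hs he hw hw' rfl)]

end IsWord

/-- If `h ⊗ u ^ s` kills the highest weight vector `w` for all `s > 1`, then so does `h ⊗ u`: if it
acts by `c`, then `(x⁺ ⊗ u) ^ m (x⁻) ^ m w = m! c ^ m w`, as a product of factors `x⁻ ⊗ u ^ i` in
which some `i` is positive contributes nothing; and the left side vanishes for large `m`. -/
lemma k_smul_eq_zero_of_pow [CharZero F] (hs : IsSlTwoCurrent E G K) {u : A} {w : V}
    (he : E u • w = 0) {c : F} (hw : K u • w = c • w) (hw' : ∀ s, K (u ^ (s + 2)) • w = 0)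
    {m : ℕ} (hm : G 1 ^ m • w = 0) : K u • w = 0 := by
  have h0 : ∀ k, IsWord G u w k false (G 1 ^ k • w) := by
    intro k
    induction k with
    | zero => simpa using IsWord.base
    | succ k ih =>
      have := ih.cons 0
      rwa [pow_zero, ← mul_smul, ← pow_succ'] at this
  -- modulo products with a positive exponent, `h ⊗ u` acts on `(x⁻) ^ k w` by `c`, and `x⁺ ⊗ u`
  -- carries `(x⁻) ^ (k + 1) w` to `(k + 1) c (x⁻) ^ k w`
  have h1 : ∀ k, IsWord G u w k true (K u • G 1 ^ k • w - c • G 1 ^ k • w) := by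
    intro k
    induction k with
    | zero => simpa [hw] using IsWord.zero _ _
    | succ k ih =>
      have h2 := (ih.cons 0).sub_two_smul ((h0 k).mark 0)
      convert h2 using 1
      rw [pow_succ', mul_smul, ← mul_smul (K u), hs.k_mul_g, pow_zero, zero_add, pow_one, mul_one,
        sub_smul, mul_smul, smul_sub, smul_assoc, smul_comm c]
      abel
  have h2 : ∀ k, IsWord G u w k true
      (E u • G 1 ^ (k + 1) • w - ((k + 1 : F) * c) • G 1 ^ k • w) := by
    intro k
    induction k with
    | zero =>
      have : E u • G 1 • w = c • w := by
        rw [← mul_smul, hs.e_mul_g, add_smul, mul_smul, he, smul_zero, zero_add, mul_one, hw]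
      simpa [this] using IsWord.zero _ _
    | succ k ih =>
      have h3 := (ih.cons 0).add (h1 (k + 1))
      have e : G 1 • G 1 ^ k • w = G 1 ^ (k + 1) • w := by rw [← mul_smul, ← pow_succ']
      convert h3 using 1
      rw [pow_succ' _ (k + 1), mul_smul, ← mul_smul (E u), hs.e_mul_g, pow_zero, mul_one,
        add_smul, mul_smul, smul_sub, smul_comm (G 1) ((k + 1 : F) * c), e]
      have : ((k + 1 : ℕ) + 1 : F) * c = (k + 1) * c + c := by push_cast; ring
      rw [this, add_smul]
      abel
  have h3 : ∀ k, E u ^ k • G 1 ^ k • w = ((k.factorial : F) * c ^ k) • w := by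
    intro k
    induction k with
    | zero => simp
    | succ k ih =>
      have h4 := (h2 k).e_pow_smul_eq_zero hs he hw hw'
      rw [smul_sub, sub_eq_zero, ← mul_smul (E u ^ k) (E u), ← pow_succ,
        smul_comm (E u ^ k) ((k + 1 : F) * c), ih] at h4
      rw [h4, smul_smul]
      congr 1
      rw [Nat.factorial_succ]
      push_cast; ring
  have h4 := h3 m
  rw [hm, smul_zero] at h4
  rcases smul_eq_zero.mp h4.symm with h5 | h5
  · have hm0 : (m.factorial : F) ≠ 0 := by exact_mod_cast m.factorial_ne_zero
    rw [hw, eq_zero_of_pow_eq_zero ((mul_eq_zero.mp h5).resolve_left hm0), zero_smul]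
  · rw [h5, smul_zero]

/-- If `h ⊗ f ^ s` kills the highest weight vector `w` for all `s > 0`, then so does `h ⊗ f g` for
every `g`. -/
lemma k_mul_smul_eq_zero [CharZero F] (hs : IsSlTwoCurrent E G K) {f : A} {w : V}
    (he : ∀ g, E g • w = 0) (hK : ∀ g, ∃ c : F, K g • w = c • w)
    (hw : ∀ s, K (f ^ (s + 1)) • w = 0) {N : ℕ} (hN : G 1 ^ (N + 1) • w = 0) (g : A) :
    K (f * g) • w = 0 := by
  have h1 : ∀ g, K (f ^ (N + 1) * g) • w = 0 := by
    intro g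
    -- `x⁺` carries `(x⁻ ⊗ f ^ (N + 1) g) w = 0` to `(h ⊗ f ^ (N + 1) g) w`
    refine k_smul_eq_zero hs he ?_
    rw [pow_succ, mul_assoc]
    exact g_mul_smul_eq_zero hs hK (g_pow_smul_eq_zero hs (he f) hw hN) _
  -- lowering the exponent `k + 2` to `k + 1`: all higher powers of `u = f ^ (k + 1) g` are multiples
  -- of `f ^ (k + 2)`
  have h2 : ∀ k, (∀ g, K (f ^ (k + 1) * g) • w = 0) → ∀ g, K (f * g) • w = 0 := by
    intro k
    induction k with
    | zero => simp
    | succ k ih =>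
      refine fun h ↦ ih fun g ↦ ?_
      obtain ⟨c, hc⟩ := hK (f ^ (k + 1) * g)
      refine k_smul_eq_zero_of_pow hs (he _) hc (fun s ↦ ?_) hN
      have e : (f ^ (k + 1) * g) ^ (s + 2) =
          f ^ (k + 1 + 1) * (f ^ k * g ^ 2 * (f ^ (k + 1) * g) ^ s) := by ring
      rw [e]
      exact h _
  exact h2 N h1 g

end SlTwo

/-! ### Logarithmic derivatives -/

section ExpCoeff

variable {F : Type*} [Field F]

/-- Algebra homomorphisms commute with the exponential of power series. -/
lemma map_expCoeff {A B : Type*} [Ring A] [Algebra F A] [Ring B] [Algebra F B] (f : A →ₐ[F] B)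
    (H : ℕ → A) (r : ℕ) : f (expCoeff F H r) = expCoeff F (fun s ↦ f (H s)) r := by
  have h : PowerSeries.map (f : A →+* B) (PowerSeries.mk fun s ↦ if s = 0 then 0 else
      (s : F)⁻¹ • H s) = PowerSeries.mk fun s ↦ if s = 0 then 0 else (s : F)⁻¹ • f (H s) := by
    ext s
    simp only [PowerSeries.coeff_map, PowerSeries.coeff_mk]
    split_ifs <;> simp
  have h2 : ∀ (c : F) (P : PowerSeries A), PowerSeries.map (f : A →+* B) (c • P) =
      c • PowerSeries.map (f : A →+* B) P := by
    intro c P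
    ext s
    simp
  rw [expCoeff, expCoeff, ← h]
  have h3 := PowerSeries.coeff_map (f : A →+* B) r (∑ k ∈ Finset.range (r + 1),
    (k.factorial : F)⁻¹ • (-PowerSeries.mk fun s ↦ if s = 0 then 0 else (s : F)⁻¹ • H s) ^ k)
  refine h3.symm.trans ?_
  rw [map_sum]
  simp only [h2, map_pow, map_neg]

open PowerSeries in
/-- If `exp (- ∑ (c s / s) u ^ s) = (1 - a u) ^ l`, then `c s = l a ^ s`: this is the comparison of
logarithmic derivatives. -/
lemma eq_mul_pow_of_expCoeff [CharZero F] {c : ℕ → F} {a : F} {l : ℕ}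
    (h : ∀ r, expCoeff F c r = ((1 - Polynomial.C a * Polynomial.X) ^ l : Polynomial F).coeff r)
    (s : ℕ) : c (s + 1) = l * a ^ (s + 1) := by
  set G : PowerSeries F := PowerSeries.mk fun s ↦ if s = 0 then 0 else (s : F)⁻¹ • c s with hG
  set T : ℕ → PowerSeries F := fun r ↦ ∑ k ∈ Finset.range (r + 1), (k.factorial : F)⁻¹ • (-G) ^ k
    with hT
  set Q : PowerSeries F := (1 - C a * X) ^ l with hQ
  have hG0 : X ∣ -G := by
    rw [X_dvd_iff]
    simp [hG]
  have hQT : ∀ r, coeff r (T r) = coeff r Q := by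
    intro r
    refine (h r).trans ?_
    rw [← Polynomial.coeff_coe]
    simp [hQ]
  -- the coefficient of `u ^ r` in the truncations of the exponential series stabilizes
  have hstab : ∀ r j, coeff r (T (r + j)) = coeff r (T r) := by
    intro r j
    induction j with
    | zero => rfl
    | succ j ih =>
      rw [← ih]
      simp only [hT]
      rw [← add_assoc, Finset.sum_range_succ _ (r + j + 1), map_add]
      have h1 : coeff r (((r + j + 1).factorial : F)⁻¹ • (-G) ^ (r + j + 1)) = 0 := by
        rw [map_smul, X_pow_dvd_iff.mp (pow_dvd_pow_of_dvd hG0 _) r (by omega), smul_zero]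
      rw [h1, add_zero]
  -- the derivative of a truncated exponential series is the shorter truncation times `-G'`
  have hderiv : ∀ r, d⁄dX F (T (r + 1)) = -(d⁄dX F G) * T r := by
    intro r
    simp only [hT]
    rw [Finset.sum_range_succ', map_add, map_sum, Finset.mul_sum]
    have h0 : d⁄dX F (((0 : ℕ).factorial : F)⁻¹ • (-G) ^ 0) = 0 := by simp
    rw [h0, add_zero]
    refine Finset.sum_congr rfl fun k _ ↦ ?_
    rw [Derivation.map_smul, Derivation.leibniz_pow, map_neg, Nat.add_sub_cancel, smul_eq_mul,
      ← Nat.cast_smul_eq_nsmul F, smul_smul, Nat.factorial_succ]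
    have h1 : ((k + 1 : ℕ) : F) ≠ 0 := by exact_mod_cast Nat.succ_ne_zero k
    have h2 : (((k + 1) * k.factorial : ℕ) : F)⁻¹ * ((k + 1 : ℕ) : F) = (k.factorial : F)⁻¹ := by
      rw [Nat.cast_mul, mul_inv]
      field_simp
    rw [h2, mul_smul_comm, mul_comm]
  have hQ' : d⁄dX F Q = -(d⁄dX F G) * Q := by
    ext r
    have h1 : coeff r (d⁄dX F (T (r + 1))) = coeff r (d⁄dX F Q) := by
      rw [coeff_derivative, coeff_derivative, hQT]
    rw [← h1, hderiv, coeff_mul, coeff_mul]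
    refine Finset.sum_congr rfl fun p hp ↦ ?_
    have hp2 : p.2 ≤ r := by
      have := Finset.HasAntidiagonal.mem_antidiagonal.mp hp
      omega
    obtain ⟨j, hj⟩ := Nat.exists_eq_add_of_le hp2
    rw [← hQT, hj, hstab]
  have hQd : (1 - C a * X) * d⁄dX F Q = -(l : PowerSeries F) * C a * Q := by
    have h1 : d⁄dX F (1 - C a * X : PowerSeries F) = -C a := by
      ext r
      rcases r with _ | r <;> simp
    rw [hQ, Derivation.leibniz_pow, h1]
    rcases l with _ | l
    · simp
    · rw [Nat.add_sub_cancel, nsmul_eq_mul, smul_eq_mul, pow_succ]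
      ring
  have hne : Q ≠ 0 := by
    have h1 : (1 - C a * X : PowerSeries F) ≠ 0 := by
      intro h0
      have := congrArg (coeff 0) h0
      simp at this
    exact pow_ne_zero _ h1
  have key : (1 - C a * X) * d⁄dX F G = (l : PowerSeries F) * C a := by
    refine mul_right_cancel₀ hne ?_
    rw [hQ'] at hQd
    linear_combination -hQd
  have hGc : ∀ s, coeff s (d⁄dX F G) = c (s + 1) := by
    intro s
    have h1 : (s + 1 : F) ≠ 0 := by exact_mod_cast Nat.succ_ne_zero s
    rw [coeff_derivative]
    simp [hG]
    field_simp
  have hl : (l : PowerSeries F) * C a = C (l * a) := by simp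
  induction s with
  | zero =>
    have := congrArg (coeff 0) key
    rw [hl, sub_mul, one_mul, mul_assoc, map_sub, hGc] at this
    simpa using this
  | succ s ih =>
    have := congrArg (coeff (s + 1)) key
    rw [hl, sub_mul, one_mul, mul_assoc, map_sub, hGc, coeff_C_mul, coeff_succ_X_mul, hGc, ih,
      coeff_C, if_neg (Nat.succ_ne_zero s), sub_eq_zero] at this
    rw [this]; ring

end ExpCoeff

/-! ### Vectors satisfying the relations of a local Weyl module -/

section WeightVector

variable {𝔤 : Type*} [LieRing 𝔤] [LieAlgebra ℂ 𝔤] [FiniteDimensional ℂ 𝔤] [IsSimple ℂ 𝔤]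
  {𝔥 : LieSubalgebra ℂ 𝔤} [𝔥.IsCartanSubalgebra] {F : Type*} [Field F]
  {C : ChevalleyBasis 𝔥} {b : (rootSystem 𝔥).Base} {n : ℕ} {l : b.support → ℕ} {a : Fin n → F}

/-- The Laurent polynomial `t_j - a_j`. -/
def coordSub (a : Fin n → F) (j : Fin n) : AddMonoidAlgebra F (Fin n →₀ ℤ) :=
  AddMonoidAlgebra.single (Finsupp.single j 1) 1 - algebraMap F _ (a j)

lemma toLaurent_translate_X (a : Fin n → F) (j : Fin n) :
    toLaurent F n (translate a (MvPolynomial.X j)) = coordSub a j := by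
  have h : toLaurent F n (MvPolynomial.X j) =
      AddMonoidAlgebra.single (Finsupp.single j 1) 1 := by
    refine (AddMonoidAlgebra.mapDomain_single ..).trans ?_
    simp
  rw [translate, MvPolynomial.aeval_X, map_sub, h, ← MvPolynomial.algebraMap_eq, AlgHom.commutes]
  rfl

lemma negRoot_negRoot (α : 𝔥.root) : negRoot (negRoot α) = α :=
  Subtype.ext (neg_neg α.1)

lemma isSlTwoCurrent_cur (M : Type*) [AddCommMonoid M] (α : 𝔥.root) :
    IsSlTwoCurrent (cur F C b M (rootVec C b α)) (cur F C b M (rootVec C b (negRoot α)))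
      (cur F C b M (corootVec C b α)) := by
  have h1 : ⁅rootVec C b α, rootVec C b (negRoot α)⁆ = corootVec C b α :=
    Subtype.ext (C.lie_x_negRoot α)
  have h2 : ⁅corootVec C b α, rootVec C b (negRoot α)⁆ = (-2 : ℤ) • rootVec C b (negRoot α) := by
    refine Subtype.ext ((lie_coroot_x C α (negRoot α)).trans ?_)
    have h3 : (rootSystem 𝔥).pairingIn ℤ (negRoot α) α = -2 := by
      have h4 := (rootSystem 𝔥).algebraMap_pairingIn ℤ (negRoot α) α
      rw [rootSystem_pairing_apply, coe_negRoot, Pi.neg_apply,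
        root_apply_coroot (root_isNonZero α)] at h4
      exact (algebraMap ℤ ℂ).injective_int (h4.trans (by simp))
    rw [h3]
    rfl
  refine ⟨fun f g ↦ ?_, fun f g ↦ ?_, fun f g ↦ ?_⟩
  · rw [← h1, cur_lie]; abel
  · have h := cur_lie (F := F) (corootVec C b α) (rootVec C b (negRoot α)) f g
    rw [h2, map_zsmul, LinearMap.smul_apply, ← Int.cast_smul_eq_zsmul F] at h
    push_cast at h
    rw [neg_smul] at h
    rw [sub_eq_add_neg, h]
    abel
  · have h := cur_lie (F := F) (rootVec C b (negRoot α)) (rootVec C b (negRoot α)) f g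
    rw [lie_self, map_zero, LinearMap.zero_apply] at h
    exact (sub_eq_zero.mp h.symm)

variable {V : Type*} [AddCommGroup V] [Module F V] [Module (Hyper F C (Fin n →₀ ℤ)) V]

variable (C b l a) in
/-- The properties of the generator of the local Weyl module with highest `ℓ`-weight
`((1 - a_j u) ^ l i)` on which the comparison with the graded local Weyl module rests. -/
structure IsWeylVector (w : V) : Prop where
  rootVec_smul : ∀ α f, b.IsPos α → cur F C b (Fin n →₀ ℤ) (rootVec C b α) f • w = 0
  corootVec_smul : ∀ α f, ∃ c : F, cur F C b (Fin n →₀ ℤ) (corootVec C b α) f • w = c • w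
  coroot_pow_smul : ∀ (i : b.support) (j : Fin n) (s : ℕ),
    cur F C b (Fin n →₀ ℤ) (corootVec C b i.1) (coordSub a j ^ (s + 1)) • w = 0
  weight_smul : ∀ i : b.support,
    hyperElt F C b (0 : Fin n →₀ ℤ) (corootVec C b i.1) • w = (l i : F) • w
  lowering_smul : ∀ (α : 𝔥.root) (m k : ℕ), b.IsPos α → domWeight b l (coroot α.1) = m → m < k →
    hyperElt F C b (0 : Fin n →₀ ℤ) (rootVec C b (negRoot α)) ^ k • w = 0

lemma cur_one (M : Type*) [AddCommMonoid M] (y : C.lattice b) :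
    cur F C b M y 1 = hyperElt F C b 0 y := by
  rw [AddMonoidAlgebra.one_def, cur_single, one_smul]

/-- The additive map `y ↦ (y ⊗ f) w`. -/
def curSmul (f : AddMonoidAlgebra F (Fin n →₀ ℤ)) (w : V) : C.lattice b →+ V :=
  AddMonoidHom.mk' (fun y ↦ cur F C b _ y f • w)
    fun y z ↦ by rw [map_add, LinearMap.add_apply, add_smul]

/-- The coroots are integral combinations of the simple coroots. -/
lemma lattice_hom_corootVec_eq_zero {B : Type*} [AddCommGroup B] (g : C.lattice b →+ B)
    (h : ∀ i : b.support, g (corootVec C b i.1) = 0) (α : 𝔥.root) : g (corootVec C b α) = 0 := by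
  have h1 : ∀ y ∈ Submodule.span ℤ (Set.range fun i : b.support ↦ (coroot i.1.1 : 𝔤)),
      ∀ hy' : y ∈ C.lattice b, g ⟨y, hy'⟩ = 0 := by
    have hle : ∀ y ∈ Submodule.span ℤ (Set.range fun i : b.support ↦ (coroot i.1.1 : 𝔤)),
        y ∈ C.lattice b := by
      intro y hy
      refine Submodule.span_mono ?_ hy
      rintro _ ⟨i, rfl⟩
      exact ⟨Sum.inr i, rfl⟩
    intro y hy
    induction hy using Submodule.span_induction with
    | mem y hy =>
      obtain ⟨i, rfl⟩ := hy
      exact fun _ ↦ h i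
    | zero => exact fun _ ↦ g.map_zero
    | add y z hy hz h h' =>
      exact fun _ ↦ (g.map_add ⟨y, hle y hy⟩ ⟨z, hle z hz⟩).trans (by rw [h, h', add_zero])
    | smul k y hy h =>
      exact fun _ ↦ (g.map_zsmul k ⟨y, hle y hy⟩).trans (by rw [h, smul_zero])
  exact h1 _ (coroot_mem_span b α) _

lemma lattice_hom_eq_zero {B : Type*} [AddCommGroup B] (g : C.lattice b →+ B)
    (h : ∀ α, g (rootVec C b α) = 0) (h' : ∀ i : b.support, g (corootVec C b i.1) = 0) :
    g = 0 := by
  have h1 : ∀ y ∈ Submodule.span ℤ (Set.range (C.vec b)), ∀ hy' : y ∈ C.lattice b,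
      g ⟨y, hy'⟩ = 0 := by
    intro y hy
    induction hy using Submodule.span_induction with
    | mem y hy =>
      obtain ⟨α | i, rfl⟩ := hy
      · exact fun _ ↦ h α
      · exact fun _ ↦ h' i
    | zero => exact fun _ ↦ g.map_zero
    | add y z hy hz h h' =>
      exact fun _ ↦ (g.map_add ⟨y, hy⟩ ⟨z, hz⟩).trans
        ((congrArg₂ _ (h hy) (h' hz)).trans (add_zero 0))
    | smul k y hy h =>
      exact fun _ ↦ (g.map_zsmul k ⟨y, hy⟩).trans ((congrArg _ (h hy)).trans (smul_zero k))
  exact AddMonoidHom.ext fun y ↦ h1 _ y.2 y.2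

variable {w : V}

namespace IsWeylVector

lemma corootVec_pow_smul (hw : IsWeylVector C b l a w) (α : 𝔥.root) (j : Fin n) (s : ℕ) :
    cur F C b (Fin n →₀ ℤ) (corootVec C b α) (coordSub a j ^ (s + 1)) • w = 0 :=
  lattice_hom_corootVec_eq_zero (curSmul (coordSub a j ^ (s + 1)) w)
    (fun i ↦ hw.coroot_pow_smul i j s) α

variable [IsScalarTower F (Hyper F C (Fin n →₀ ℤ)) V] [CharZero F]

/-- All `h_α ⊗ (t_j - a_j) g` kill the generator. -/
lemma corootVec_mul_smul (hw : IsWeylVector C b l a w) {α : 𝔥.root} (hα : b.IsPos α) (j : Fin n)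
    (g : AddMonoidAlgebra F (Fin n →₀ ℤ)) :
    cur F C b (Fin n →₀ ℤ) (corootVec C b α) (coordSub a j * g) • w = 0 := by
  obtain ⟨m, hm⟩ := exists_domWeight_coroot_eq b l hα
  refine k_mul_smul_eq_zero (isSlTwoCurrent_cur _ α) (fun g ↦ hw.rootVec_smul α g hα)
    (hw.corootVec_smul α) (hw.corootVec_pow_smul α j) (N := m) ?_ g
  rw [cur_one]
  exact hw.lowering_smul α m (m + 1) hα hm m.lt_succ_self

/-- There is an `N` such that `y ⊗ (t_j - a_j) ^ N g` kills the generator for all `y ∈ 𝔤`. -/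
lemma exists_cur_pow_mul_smul (hw : IsWeylVector C b l a w) : ∃ N : ℕ, ∀ (y : C.lattice b) (j : Fin n)
    (g : AddMonoidAlgebra F (Fin n →₀ ℤ)),
    cur F C b (Fin n →₀ ℤ) y (coordSub a j ^ N * g) • w = 0 := by
  have hm : ∀ α : 𝔥.root, ∃ m : ℕ, b.IsPos α → domWeight b l (coroot α.1) = m := by
    intro α
    by_cases hα : b.IsPos α
    · obtain ⟨m, hm⟩ := exists_domWeight_coroot_eq b l hα
      exact ⟨m, fun _ ↦ hm⟩
    · exact ⟨0, fun h ↦ absurd h hα⟩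
  choose m hm using hm
  set N := ∑ α, m α with hN
  have hmN : ∀ α, m α ≤ N := fun α ↦ Finset.single_le_sum (f := m) (fun _ _ ↦ Nat.zero_le _)
    (Finset.mem_univ α)
  have hneg : ∀ (α : 𝔥.root) (j : Fin n) (g : AddMonoidAlgebra F (Fin n →₀ ℤ)), b.IsPos α →
      cur F C b (Fin n →₀ ℤ) (rootVec C b (negRoot α)) (coordSub a j ^ N * g) • w = 0 := by
    intro α j g hα
    have hs := isSlTwoCurrent_cur (F := F) (C := C) (b := b) (Fin n →₀ ℤ) α
    refine g_mul_smul_eq_zero hs (hw.corootVec_smul α) (g_pow_smul_eq_zero hs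
      (hw.rootVec_smul α _ hα) (hw.corootVec_pow_smul α j) ?_) g
    rw [cur_one]
    exact hw.lowering_smul α _ _ hα (hm α hα) (Nat.lt_succ_of_le (hmN α))
  -- by additivity, it suffices to consider the members of the Chevalley basis
  refine ⟨N, fun y j g ↦ DFunLike.congr_fun (lattice_hom_eq_zero
    (curSmul (b := b) (coordSub a j ^ N * g) w) (fun α ↦ ?_) fun i ↦ ?_) y⟩
  · rcases isPos_or_isPos_negRoot b α with hα | hα
    · exact hw.rootVec_smul α _ hα
    · have := hneg (negRoot α) j g hα
      rwa [negRoot_negRoot] at this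
  · have hi : b.IsPos i.1 := b.isPos_of_mem_support i.2
    exact k_smul_eq_zero (isSlTwoCurrent_cur _ i.1) (fun g ↦ hw.rootVec_smul i.1 g hi)
      (hneg i.1 j g hi)

end IsWeylVector

variable [IsScalarTower F (Hyper F C (Fin n →₀ ℤ)) V] [CharZero F]

/-- If `w` is killed by the images under `Ψ` of a spanning set of a Lie subalgebra, then it is killed
by the image of the augmentation ideal of its hyperalgebra. -/
lemma augmentation_smul_eq_zero {M : Type*} [AddCommMonoid M] {S : Set (loopAlgebra ℂ M 𝔤)}
    {T : Set (M × C.lattice b)} (hS : ∀ s ∈ S, s ∈ Submodule.span ℂ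
      ((fun q : M × C.lattice b ↦
        (AddMonoidAlgebra.single q.1 1 ⊗ₜ[ℂ] (q.2 : 𝔤) : loopAlgebra ℂ M 𝔤)) '' T))
    (Ψ : Hyper F C M →ₐ[F] Hyper F C (Fin n →₀ ℤ))
    (hT : ∀ q ∈ T, Ψ (hyperElt F C b q.1 q.2) • w = 0)
    {z : Hyper F C M} (hz : z ∈ augmentation F C S) : Ψ z • w = 0 := by
  obtain ⟨⟨u, hu1, hu2⟩, hu0, rfl⟩ := hz
  have hX : IsCurrentRep (fun _ ↦ 0 : M → C.lattice b →+ F) := by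
    intro m m' y z
    simp
  have h1 : ∀ z ∈ Algebra.adjoin F ((fun q : M × C.lattice b ↦ hyperElt F C b q.1 q.2) '' T),
      Ψ z • w = hyperLift F hX z • w := by
    intro z hz
    induction hz using Algebra.adjoin_induction with
    | mem z hz =>
      obtain ⟨q, hq, rfl⟩ := hz
      simp only
      rw [hT q hq, hyperLift_hyperElt, AddMonoidHom.zero_apply, zero_smul]
    | algebraMap c => rw [AlgHom.commutes, AlgHom.commutes, algebraMap_smul]; rfl
    | add _ _ _ _ h h' => rw [map_add, map_add, add_smul, add_smul, h, h']
    | mul _ _ _ _ h h' => rw [map_mul, map_mul, mul_smul, h', smul_comm, h, smul_smul, mul_comm]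
  have h2 := h1 _ (one_tmul_mem_adjoin hS ⟨u, hu1⟩ hu2)
  rw [hyperLift_zero_one_tmul hX ⟨u, hu1⟩ hu0, zero_smul] at h2
  exact h2

end WeightVector

/-! ### The relations of the graded local Weyl module -/

section Relations

variable {𝔤 : Type*} [LieRing 𝔤] [LieAlgebra ℂ 𝔤] [FiniteDimensional ℂ 𝔤] [IsSimple ℂ 𝔤]
  {𝔥 : LieSubalgebra ℂ 𝔤} [𝔥.IsCartanSubalgebra] {F : Type*} [Field F]
  {C : ChevalleyBasis 𝔥} {b : (rootSystem 𝔥).Base} {n : ℕ} {l : b.support → ℕ} {a : Fin n → F}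
  {V : Type*} [AddCommGroup V] [Module F V] [Module (Hyper F C (Fin n →₀ ℤ)) V]
  [IsScalarTower F (Hyper F C (Fin n →₀ ℤ)) V] {w : V}

lemma nPlus_subset_span (M : Type*) [AddCommMonoid M] : ∀ s ∈ nPlus C b M, s ∈ Submodule.span ℂ
    ((fun q : M × C.lattice b ↦
      (AddMonoidAlgebra.single q.1 1 ⊗ₜ[ℂ] (q.2 : 𝔤) : loopAlgebra ℂ M 𝔤)) ''
        {q | ∃ α, b.IsPos α ∧ q.2 = rootVec C b α}) := by
  rintro _ ⟨α, f, hα, rfl⟩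
  induction f using AddMonoidAlgebra.induction_linear with
  | zero => rw [TensorProduct.zero_tmul]; exact zero_mem _
  | add _ _ h h' => rw [TensorProduct.add_tmul]; exact add_mem h h'
  | single m c =>
    have h : (AddMonoidAlgebra.single m c : AddMonoidAlgebra ℂ M) =
        c • AddMonoidAlgebra.single m 1 := by simp
    rw [h, ← TensorProduct.smul_tmul']
    exact Submodule.smul_mem _ _ (Submodule.subset_span ⟨(m, rootVec C b α), ⟨α, hα, rfl⟩, rfl⟩)

lemma cartanZero_subset_span : ∀ s ∈ cartanZero 𝔥 n, s ∈ Submodule.span ℂ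
    ((fun q : (Fin n →₀ ℕ) × C.lattice b ↦
      (AddMonoidAlgebra.single q.1 1 ⊗ₜ[ℂ] (q.2 : 𝔤) : loopAlgebra ℂ (Fin n →₀ ℕ) 𝔤)) ''
        {q | q.1 ≠ 0 ∧ ∃ i : b.support, q.2 = corootVec C b i.1}) := by
  rintro _ ⟨h, f, hf, rfl⟩
  have hh : h ∈ Submodule.span ℂ ((rootSystem 𝔥).coroot '' b.support) := by
    rw [b.span_coroot_support, RootPairing.corootSpan,
      RootPairing.IsRootSystem.span_coroot_eq_top]
    trivial
  induction hh using Submodule.span_induction with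
  | zero => rw [ZeroMemClass.coe_zero, TensorProduct.tmul_zero]; exact zero_mem _
  | add _ _ _ _ h h' =>
    rw [AddMemClass.coe_add, TensorProduct.tmul_add]; exact add_mem h h'
  | smul c _ _ h =>
    rw [SetLike.val_smul, TensorProduct.tmul_smul]; exact Submodule.smul_mem _ c h
  | mem h hh =>
    obtain ⟨i, hi, rfl⟩ := hh
    rw [f.as_sum, TensorProduct.sum_tmul]
    refine Submodule.sum_mem _ fun m hm ↦ ?_
    have hm0 : m ≠ 0 := by
      rintro rfl
      rw [MvPolynomial.mem_support_iff, ← MvPolynomial.constantCoeff_eq] at hm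
      rw [MvPolynomial.eval_zero] at hf
      exact hm hf
    have e : (MvPolynomial.monomial m (f.coeff m) : MvPolynomial (Fin n) ℂ) =
        f.coeff m • (AddMonoidAlgebra.single m 1 : AddMonoidAlgebra ℂ (Fin n →₀ ℕ)) := by
      rw [AddMonoidAlgebra.smul_single, smul_eq_mul, mul_one]
      rfl
    rw [e, ← TensorProduct.smul_tmul']
    exact Submodule.smul_mem _ _ (Submodule.subset_span
      ⟨(m, corootVec C b i), ⟨hm0, ⟨i, hi⟩, rfl⟩, rfl⟩)

lemma aeval_smul_eq_eval_smul {h : Hyper F C (Fin n →₀ ℤ)} {c : F} (hw : h • w = c • w)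
    (p : Polynomial F) : Polynomial.aeval h p • w = p.eval c • w := by
  induction p using Polynomial.induction_on' with
  | add p q hp hq => rw [map_add, add_smul, hp, hq, Polynomial.eval_add, add_smul]
  | monomial k r =>
    have h1 : h ^ k • w = c ^ k • w := by
      induction k with
      | zero => simp
      | succ k ih => rw [pow_succ', mul_smul, ih, smul_comm, hw, smul_smul, pow_succ]
    rw [Polynomial.aeval_monomial, Polynomial.eval_monomial, mul_smul, algebraMap_smul, h1,
      smul_smul]

/-- The hyperalgebra elements `binom h_i k` are polynomials in `h_i`. -/
lemma factorial_smul_one_tmul_binomial {M : Type*} [AddCommMonoid M] (i : b.support) (k : ℕ)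
    (u : intForm C M) (hu : (u : Env M 𝔤) = binomial (elt 0 (coroot i.1.1 : 𝔤)) k) :
    (k.factorial : F) • (1 ⊗ₜ u : Hyper F C M) =
      Polynomial.aeval (hyperElt F C b 0 (corootVec C b i.1)) (descPochhammer F k) := by
  have hC : (k.factorial : ℂ) ≠ 0 := by exact_mod_cast k.factorial_ne_zero
  set x : intForm C M := ⟨elt 0 (coroot i.1.1 : 𝔤), elt_mem_intForm 0 (corootVec C b i.1).2⟩
    with hx
  have h1 : (k.factorial : ℤ) • u = Polynomial.aeval x (descPochhammer ℤ k) := by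
    apply Subtype.ext
    have h2 : ((Polynomial.aeval x (descPochhammer ℤ k) : intForm C M) : Env M 𝔤) =
        Polynomial.aeval (elt 0 (coroot i.1.1 : 𝔤) : Env M 𝔤) (descPochhammer ℤ k) :=
      (Polynomial.aeval_algHom_apply (intForm C M).val x _).symm
    rw [h2, SetLike.val_smul, hu, binomial, ← Int.cast_smul_eq_zsmul ℂ, smul_smul,
      ← descPochhammer_map (Int.castRingHom ℂ), ← algebraMap_int_eq, Polynomial.aeval_map_algebraMap]
    simp [hC]
  rw [← descPochhammer_map (Int.castRingHom F), ← algebraMap_int_eq,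
    Polynomial.aeval_map_algebraMap]
  have h3 := Polynomial.aeval_algHom_apply
    (Algebra.TensorProduct.includeRight : intForm C M →ₐ[ℤ] Hyper F C M) x (descPochhammer ℤ k)
  refine Eq.trans ?_ h3.symm
  rw [← h1, ← Int.cast_natCast, Int.cast_smul_eq_zsmul, ← TensorProduct.tmul_smul]
  rfl

variable [CharZero F]

variable (C b) in
/-- The homomorphism `y ⊗ f(t) ↦ y ⊗ f(t - a)` from the hyperalgebra of `𝔤[n]` to that of
`𝔤⟨n⟩`. -/
def shiftToLoop (a : Fin n → F) : Hyper F C (Fin n →₀ ℕ) →ₐ[F] Hyper F C (Fin n →₀ ℤ) :=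
  (currentToLoop F C n).comp (shiftEquiv C b a : Hyper F C (Fin n →₀ ℕ) →ₐ[F] _)

lemma shiftToLoop_hyperElt (a : Fin n → F) (m : Fin n →₀ ℕ) (y : C.lattice b) :
    shiftToLoop C b a (hyperElt F C b m y) = cur F C b _ y
      (toLaurent F n (translate a (MvPolynomial.monomial m 1))) := by
  have h : hyperElt F C b m y = cur F C b _ y (AddMonoidAlgebra.single m 1) := by
    rw [cur_single, one_smul]
  rw [h]
  refine (congrArg (currentToLoop F C n) (shiftEquiv_cur a y _)).trans ?_
  rw [currentToLoop_cur]
  rfl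

lemma shiftToLoop_hyperElt_zero (a : Fin n → F) (y : C.lattice b) :
    shiftToLoop C b a (hyperElt F C b 0 y) = hyperElt F C b 0 y := by
  rw [shiftToLoop_hyperElt]
  have : (MvPolynomial.monomial 0 1 : MvPolynomial (Fin n) F) = 1 := rfl
  rw [this, map_one, map_one, cur_one]

/-- The generator of the local Weyl module, shifted by `a`, satisfies the defining relations of the
graded local Weyl module. -/
lemma IsWeylVector.shiftToLoop_smul_eq_zero (hw : IsWeylVector C b l a w)
    {z : Hyper F C (Fin n →₀ ℕ)} (hz : z ∈ gradedWeylIdeal F C b n l) :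
    shiftToLoop C b a z • w = 0 := by
  rw [gradedWeylIdeal] at hz
  induction hz using Submodule.span_induction with
  | zero => rw [map_zero]; exact zero_smul (Hyper F C (Fin n →₀ ℤ)) w
  | add _ _ _ _ h h' => rw [map_add, add_smul, h, h', add_zero]
  | smul c _ _ h => rw [smul_eq_mul, map_mul, mul_smul, h, smul_zero]
  | mem z hz =>
    rcases hz with ((hz | hz) | hz) | hz
    · refine augmentation_smul_eq_zero (nPlus_subset_span _) _ ?_ hz
      rintro ⟨m, y⟩ ⟨α, hα, rfl⟩
      simp only
      rw [shiftToLoop_hyperElt]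
      exact hw.rootVec_smul α _ hα
    · refine augmentation_smul_eq_zero (cartanZero_subset_span (C := C) (b := b)) _ ?_ hz
      rintro ⟨m, y⟩ ⟨hm, i, hy⟩
      simp only at hm hy ⊢
      obtain ⟨j, hj⟩ : ∃ j, m j ≠ 0 := by
        by_contra! h
        exact hm (Finsupp.ext h)
      have e : (MvPolynomial.monomial m 1 : MvPolynomial (Fin n) F) =
          MvPolynomial.X j * MvPolynomial.monomial (m - Finsupp.single j 1) 1 := by
        rw [MvPolynomial.X, MvPolynomial.monomial_mul, one_mul,
          add_tsub_cancel_of_le (by simpa [Nat.one_le_iff_ne_zero] using hj)]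
      rw [hy, shiftToLoop_hyperElt, e, map_mul, map_mul, toLaurent_translate_X]
      exact hw.corootVec_mul_smul (b.isPos_of_mem_support i.2) j _
    · obtain ⟨i, k, u, hu, rfl⟩ := hz
      have hk : (k.factorial : F) ≠ 0 := by exact_mod_cast k.factorial_ne_zero
      have h1 := congrArg (fun z ↦ shiftToLoop C b a z • w)
        (factorial_smul_one_tmul_binomial (F := F) i k u hu)
      rw [← Polynomial.aeval_algHom_apply, shiftToLoop_hyperElt_zero,
        aeval_smul_eq_eval_smul (hw.weight_smul i), map_smul, smul_assoc,
        descPochhammer_eval_eq_descFactorial, Nat.descFactorial_eq_factorial_mul_choose,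
        Nat.cast_mul, mul_smul] at h1
      rw [map_sub, sub_smul, smul_right_injective _ hk h1, AlgHom.commutes, algebraMap_smul,
        sub_self]
    · obtain ⟨α, m, k, hα, hm, hk, rfl⟩ := hz
      rw [divPow_eq b, map_smul, map_pow, shiftToLoop_hyperElt_zero, smul_assoc,
        hw.lowering_smul α m k hα hm hk, smul_zero]

end Relations

/-! ### Surjectivity and the generator of the local Weyl module -/

section Surjectivity

variable {𝔤 : Type*} [LieRing 𝔤] [LieAlgebra ℂ 𝔤] [FiniteDimensional ℂ 𝔤] [IsSimple ℂ 𝔤]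
  {𝔥 : LieSubalgebra ℂ 𝔤} [𝔥.IsCartanSubalgebra] {F : Type*} [Field F]
  {C : ChevalleyBasis 𝔥} {b : (rootSystem 𝔥).Base} {n : ℕ} {l : b.support → ℕ} {a : Fin n → F}

/-- Modulo any powers of the `t_j - a_j`, every Laurent polynomial is congruent to a polynomial: if
`a_j ≠ 0`, then `t_j` is invertible modulo `(t_j - a_j) ^ N` in `F[t_j]`; if `a_j = 0`, then
`(t_j - a_j) ^ N` is a unit of the Laurent polynomial ring. -/
lemma exists_sub_toLaurent_mem {I : Ideal (AddMonoidAlgebra F (Fin n →₀ ℤ))} {N : ℕ}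
    (hI : ∀ j, coordSub a j ^ N ∈ I) (f : AddMonoidAlgebra F (Fin n →₀ ℤ)) :
    ∃ p, f - toLaurent F n p ∈ I := by
  set q : AddMonoidAlgebra F (Fin n →₀ ℤ) →ₐ[F] _ := Ideal.Quotient.mkₐ F I with hq
  set S := (q.comp (toLaurent F n)).range with hS
  have hX : ∀ j, q (AddMonoidAlgebra.single (Finsupp.single j 1) 1) ∈ S := by
    intro j
    refine ⟨MvPolynomial.X j, congrArg q ?_⟩
    refine (AddMonoidAlgebra.mapDomain_single ..).trans ?_
    simp
  have hXinv : ∀ j, q (AddMonoidAlgebra.single (Finsupp.single j (-1)) 1) ∈ S := by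
    intro j
    set t : AddMonoidAlgebra F (Fin n →₀ ℤ) := AddMonoidAlgebra.single (Finsupp.single j 1) 1
      with ht
    set t' : AddMonoidAlgebra F (Fin n →₀ ℤ) := AddMonoidAlgebra.single (Finsupp.single j (-1)) 1
      with ht'
    have htt : t * t' = 1 := by
      rw [ht, ht', AddMonoidAlgebra.single_mul_single, ← Finsupp.single_add]
      simp [AddMonoidAlgebra.one_def]
    have hn : q (coordSub a j ^ N) = 0 := Ideal.Quotient.eq_zero_iff_mem.mpr (hI j)
    by_cases ha : a j = 0
    · have h1 : coordSub a j ^ N * t' ^ N = 1 := by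
        rw [coordSub, ha, map_zero, sub_zero, ← mul_pow, htt, one_pow]
      have h2 : q t' = 0 := by
        rw [← one_mul t', ← h1, map_mul, map_mul, hn, zero_mul, zero_mul]
      rw [h2]
      exact zero_mem S
    · obtain ⟨p, r, hpr⟩ : IsCoprime (Polynomial.X : Polynomial F)
          ((Polynomial.X - Polynomial.C (a j)) ^ N) := by
        refine IsCoprime.pow_right ?_
        have := Polynomial.isCoprime_X_sub_C_of_isUnit_sub (R := F) (a := 0) (b := a j)
          (by simpa using ha)
        simpa using this
      have h1 := congrArg (Polynomial.aeval (q t)) hpr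
      have h2 : Polynomial.aeval (q t) ((Polynomial.X - Polynomial.C (a j)) ^ N) = 0 := by
        rw [← hn, map_pow, map_pow, map_sub, Polynomial.aeval_X, Polynomial.aeval_C, coordSub,
          map_sub, AlgHom.commutes]
      rw [map_add, map_mul, map_mul, h2, mul_zero, add_zero, Polynomial.aeval_X, map_one] at h1
      have h3 : q t' = Polynomial.aeval (q t) p := by
        have h4 : q t * q t' = 1 := by rw [← map_mul, htt, map_one]
        calc q t' = (Polynomial.aeval (q t) p * q t) * q t' := by rw [h1, one_mul]
          _ = Polynomial.aeval (q t) p := by rw [mul_assoc, h4, mul_one]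
      rw [h3]
      exact Algebra.adjoin_le (Set.singleton_subset_iff.mpr (hX j))
        (Polynomial.aeval_mem_adjoin_singleton F (q t))
  have hpow : ∀ j (k : ℤ), q (AddMonoidAlgebra.single (Finsupp.single j k) 1) ∈ S := by
    intro j k
    have hnat : ∀ (e : Fin n →₀ ℤ) (k : ℕ), q (AddMonoidAlgebra.single e 1) ∈ S →
        q (AddMonoidAlgebra.single (k • e) 1) ∈ S := by
      intro e k he
      have := pow_mem he k
      rwa [← map_pow, AddMonoidAlgebra.single_pow, one_pow] at this
    obtain ⟨k, rfl | rfl⟩ := k.eq_nat_or_neg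
    · simpa using hnat _ k (hX j)
    · simpa using hnat _ k (hXinv j)
  have hmono : ∀ m : Fin n →₀ ℤ, q (AddMonoidAlgebra.single m 1) ∈ S := by
    intro m
    induction m using Finsupp.induction_linear with
    | zero => rw [← AddMonoidAlgebra.one_def, map_one]; exact one_mem S
    | add m m' h h' =>
      have := mul_mem h h'
      rwa [← map_mul, AddMonoidAlgebra.single_mul_single, one_mul] at this
    | single j k => exact hpow j k
  have hall : q f ∈ S := by
    induction f using AddMonoidAlgebra.induction_linear with
    | zero => rw [map_zero]; exact zero_mem S
    | add _ _ h h' => rw [map_add]; exact add_mem h h'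
    | single m c =>
      have h : AddMonoidAlgebra.single m c = c • AddMonoidAlgebra.single m (1 : F) := by simp
      rw [h, map_smul]
      exact S.smul_mem (hmono m) c
  obtain ⟨p, hp⟩ := hall
  exact ⟨p, Ideal.Quotient.eq.mp hp.symm⟩

variable [CharZero F] {V : Type*} [AddCommGroup V] [Module F V] [Module (Hyper F C (Fin n →₀ ℤ)) V]
  [IsScalarTower F (Hyper F C (Fin n →₀ ℤ)) V] {w : V}

/-- The vectors killed by all `y ⊗ f g` form a submodule, as `[y ⊗ f g, z ⊗ p]` is of the form
`y' ⊗ f g'`. -/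
lemma cur_mul_smul_smul_eq_zero {f : AddMonoidAlgebra F (Fin n →₀ ℤ)}
    (hw : ∀ (y : C.lattice b) (g : AddMonoidAlgebra F (Fin n →₀ ℤ)),
      cur F C b _ y (f * g) • w = 0) (h : Hyper F C (Fin n →₀ ℤ)) (y : C.lattice b)
    (g : AddMonoidAlgebra F (Fin n →₀ ℤ)) : cur F C b _ y (f * g) • h • w = 0 := by
  have hh : h ∈ Algebra.adjoin F {z | ∃ (α : 𝔥.root) (m : Fin n →₀ ℤ),
      z = hyperElt F C b m (rootVec C b α)} := by
    rw [adjoin_rootVec_eq_top]; trivial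
  induction hh using Algebra.adjoin_induction generalizing w y g with
  | mem z hz =>
    obtain ⟨α, m, rfl⟩ := hz
    have h1 := cur_lie (F := F) y (rootVec C b α) (f * g) (AddMonoidAlgebra.single m 1)
    rw [cur_single, one_smul, mul_assoc, eq_sub_iff_add_eq] at h1
    rw [← mul_smul, ← h1, add_smul, hw, mul_smul, hw, smul_zero, add_zero]
  | algebraMap c => rw [algebraMap_smul, smul_comm, hw, smul_zero]
  | add _ _ _ _ h h' => rw [add_smul, smul_add, h hw, h' hw, add_zero]
  | mul z z' _ _ h h' => rw [mul_smul]; exact h (fun y g ↦ h' hw y g) y g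

/-- On the module generated by `w`, the hyperalgebra of `𝔤[n]` acts through the same operators as the
hyperalgebra of `𝔤⟨n⟩`. -/
lemma IsWeylVector.exists_currentToLoop_smul (hw : IsWeylVector C b l a w)
    (h : Hyper F C (Fin n →₀ ℤ)) : ∃ r, h • w = currentToLoop F C n r • w := by
  obtain ⟨N, hN⟩ := hw.exists_cur_pow_mul_smul
  set I : Ideal (AddMonoidAlgebra F (Fin n →₀ ℤ)) :=
    Ideal.span (Set.range fun j ↦ coordSub a j ^ N) with hI
  have hIw : ∀ f ∈ I, ∀ (y : C.lattice b) (z : Hyper F C (Fin n →₀ ℤ)),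
      cur F C b _ y f • z • w = 0 := by
    intro f hf y z
    induction hf using Submodule.closure_induction with
    | zero => rw [map_zero]; exact zero_smul (Hyper F C (Fin n →₀ ℤ)) (z • w)
    | add _ _ _ _ h h' => rw [map_add, add_smul, h, h', add_zero]
    | smul_mem g f hf =>
      obtain ⟨j, rfl⟩ := hf
      rw [smul_eq_mul, mul_comm]
      exact cur_mul_smul_smul_eq_zero (fun y g ↦ hN y j g) z y g
  have hh : h ∈ Algebra.adjoin F {z | ∃ (α : 𝔥.root) (m : Fin n →₀ ℤ),
      z = hyperElt F C b m (rootVec C b α)} := by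
    rw [adjoin_rootVec_eq_top]; trivial
  -- one `r` has to serve for all vectors of the module, for the induction to pass to products
  have key : ∃ r, ∀ z : Hyper F C (Fin n →₀ ℤ), h • z • w = currentToLoop F C n r • z • w := by
    induction hh using Algebra.adjoin_induction with
    | mem h hh =>
      obtain ⟨α, m, rfl⟩ := hh
      obtain ⟨p, hp⟩ := exists_sub_toLaurent_mem (I := I)
        (fun j ↦ Ideal.subset_span ⟨j, rfl⟩) (AddMonoidAlgebra.single m 1)
      refine ⟨cur F C b _ (rootVec C b α) p, fun z ↦ ?_⟩
      have h1 := hIw _ hp (rootVec C b α) z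
      rw [map_sub, sub_smul, sub_eq_zero, cur_single, one_smul] at h1
      rw [currentToLoop_cur, h1]
    | algebraMap c => exact ⟨algebraMap F _ c, fun z ↦ by rw [AlgHom.commutes]⟩
    | add _ _ _ _ h h' =>
      obtain ⟨r, hr⟩ := h
      obtain ⟨r', hr'⟩ := h'
      exact ⟨r + r', fun z ↦ by rw [add_smul, hr, hr', map_add, add_smul]⟩
    | mul h₁ h₂ _ _ h h' =>
      obtain ⟨r, hr⟩ := h
      obtain ⟨r', hr'⟩ := h'
      refine ⟨r * r', fun z ↦ ?_⟩
      rw [mul_smul, ← mul_smul h₂, hr, mul_smul, hr', map_mul, mul_smul]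
  obtain ⟨r, hr⟩ := key
  exact ⟨r, by simpa using hr 1⟩

end Surjectivity

section Pullback

/-- If a vector `w` generates `V` over `A` and is killed by the image of the left ideal `I`, then `V`
is a quotient of `A ⧸ I`. -/
lemma exists_surjective_pullback {A B V : Type*} [Ring A] [Ring B] [AddCommGroup V] [Module B V]
    {σ : A →+* A} {τ : A →+* B} (hσ : Function.Surjective σ) {I : Submodule A A} {w : V}
    (hw : ∀ x : V, ∃ r, τ r • w = x) (hI : ∀ z ∈ I, τ (σ z) • w = 0) :
    ∃ π : A ⧸ I →ₗ[A] Pullback σ (Pullback τ V), Function.Surjective π := by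
  let g : Pullback σ (Pullback τ V) := w
  refine ⟨I.liftQ (LinearMap.toSpanSingleton _ _ g)
    fun z hz ↦ LinearMap.mem_ker.mpr (hI z hz), fun x ↦ ?_⟩
  obtain ⟨r, hr⟩ := hw x
  obtain ⟨s, rfl⟩ := hσ r
  exact ⟨Submodule.Quotient.mk s, hr⟩

lemma isScalarTower_compHom (R A V : Type*) [CommRing R] [Ring A] [Algebra R A] [AddCommGroup V]
    [Module A V] :
    letI : Module R V := Module.compHom V (algebraMap R A)
    IsScalarTower R A V :=
  letI : Module R V := Module.compHom V (algebraMap R A)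
  ⟨fun c z x ↦ (congrArg (· • x) (Algebra.smul_def c z)).trans (mul_smul _ z x)⟩

end Pullback

section LocalWeyl

variable {𝔤 : Type*} [LieRing 𝔤] [LieAlgebra ℂ 𝔤] [FiniteDimensional ℂ 𝔤] [IsSimple ℂ 𝔤]
  {𝔥 : LieSubalgebra ℂ 𝔤} [𝔥.IsCartanSubalgebra] {F : Type*} [Field F] [CharZero F]
  {C : ChevalleyBasis 𝔥} {b : (rootSystem 𝔥).Base} {n : ℕ} {l : b.support → ℕ} {a : Fin n → F}
  {ω : SubHyper F C (Fin n →₀ ℤ) (cartan 𝔥 (Fin n →₀ ℤ)) →ₐ[F] F}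
  {V : Type*} [AddCommGroup V] [Module F V] [Module (Hyper F C (Fin n →₀ ℤ)) V]
  [IsScalarTower F (Hyper F C (Fin n →₀ ℤ)) V] {w : V}

omit [CharZero F] in
lemma incl_smul_of_localWeyl (hV : ∀ z ∈ localWeylIdeal F C b n l ω, z • w = 0)
    (h : SubHyper F C (Fin n →₀ ℤ) (cartan 𝔥 (Fin n →₀ ℤ))) :
    SubHyper.incl F C (Fin n →₀ ℤ) (cartan 𝔥 _) h • w = ω h • w := by
  have h1 := hV _
    (Submodule.subset_span (Or.inl (Or.inr ⟨h, rfl⟩)))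
  rw [sub_smul, sub_eq_zero, algebraMap_smul] at h1
  exact h1

variable (ω) in
/-- The linear form `f ↦ ω (h_α ⊗ f)` on the ring of Laurent polynomials. -/
def corootForm (α : 𝔥.root) : AddMonoidAlgebra F (Fin n →₀ ℤ) →ₗ[F] F :=
  Finsupp.linearCombination F (fun m ↦ ω (1 ⊗ₜ ⟨elt m (coroot α.1 : 𝔤),
    elt_coroot_mem_subIntForm C α m⟩)) ∘ₗ (AddMonoidAlgebra.coeffLinearEquiv F).toLinearMap

omit [CharZero F] in
lemma corootForm_single (α : 𝔥.root) (m : Fin n →₀ ℤ) (c : F) :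
    corootForm ω α (AddMonoidAlgebra.single m c) = c * ω (1 ⊗ₜ ⟨elt m (coroot α.1 : 𝔤),
      elt_coroot_mem_subIntForm C α m⟩) := by
  simp [corootForm]

omit [CharZero F] in
lemma cur_corootVec_smul_of_localWeyl (hV : ∀ z ∈ localWeylIdeal F C b n l ω, z • w = 0)
    (α : 𝔥.root) (f : AddMonoidAlgebra F (Fin n →₀ ℤ)) :
    cur F C b _ (corootVec C b α) f • w = corootForm ω α f • w := by
  induction f using AddMonoidAlgebra.induction_linear with
  | zero =>
    rw [map_zero, map_zero]
    exact (zero_smul (Hyper F C (Fin n →₀ ℤ)) w).trans (zero_smul F w).symm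
  | add _ _ h h' => rw [map_add, map_add, add_smul, add_smul, h, h']
  | single m c =>
    rw [cur_single, corootForm_single, smul_assoc, mul_smul, ← incl_smul_of_localWeyl hV]
    rfl

omit [CharZero F] in
lemma corootForm_one (hω : IsLWeight F C b l a ω) (i : b.support) :
    corootForm ω i.1 1 = l i := by
  have h := hω.binom i 1 ⟨elt 0 (coroot i.1.1 : 𝔤), elt_coroot_mem_subIntForm C i.1 0⟩
    (by simp [binomial])
  rw [AddMonoidAlgebra.one_def, corootForm_single, one_mul]
  simpa using h

/-- The functional `ω` evaluates `h_i ⊗ p(t_j)` as `λ(h_i) p(a_j)`. -/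
lemma corootForm_aeval (hω : IsLWeight F C b l a ω) (i : b.support) (j : Fin n)
    (p : Polynomial F) :
    corootForm ω i.1 (Polynomial.aeval (AddMonoidAlgebra.single (Finsupp.single j 1) 1) p) =
      l i * p.eval (a j) := by
  induction p using Polynomial.induction_on' with
  | add p q hp hq => rw [map_add, map_add, hp, hq, Polynomial.eval_add, mul_add]
  | monomial k r =>
    have h1 : corootForm ω i.1 (AddMonoidAlgebra.single (Finsupp.single j (k : ℤ)) 1) =
        l i * a j ^ k := by
      rcases k with _ | k
      · rw [pow_zero, mul_one, ← corootForm_one hω i, AddMonoidAlgebra.one_def, Nat.cast_zero,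
          Finsupp.single_zero]
      · rw [corootForm_single, one_mul]
        refine eq_mul_pow_of_expCoeff (c := fun s ↦ ω (cartanElt F C b n i j s)) (fun r ↦ ?_) k
        rw [← map_expCoeff]
        exact hω.lam i j r
    rw [Polynomial.aeval_monomial, AddMonoidAlgebra.single_pow, one_pow, ← Algebra.smul_def,
      map_smul, Polynomial.eval_monomial]
    have h2 : k • (Finsupp.single j 1 : Fin n →₀ ℤ) = Finsupp.single j (k : ℤ) := by simp
    rw [h2, h1, smul_eq_mul]
    ring

omit [CharZero F] in
lemma hyperElt_mem_augmentation {M : Type*} [AddCommMonoid M] {α : 𝔥.root} (hα : b.IsPos α)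
    (m : M) : hyperElt F C b m (rootVec C b α) ∈ augmentation F C (nPlus C b M) := by
  have h : elt m (C.x α) ∈ envelope (nPlus C b M) :=
    Algebra.subset_adjoin (Set.mem_image_of_mem _ ⟨α, AddMonoidAlgebra.single m 1, hα, rfl⟩)
  have h0 : counit M 𝔤 (elt m (C.x α)) = 0 := by
    rw [counit, elt, UniversalEnvelopingAlgebra.lift_ι_apply, LieHom.zero_apply]
  exact ⟨⟨elt m (C.x α), Algebra.mem_inf.mpr ⟨elt_x_mem C α m, h⟩⟩, h0, rfl⟩

/-- The defining relations of the local Weyl module, rewritten in terms of the elements `y ⊗ f`. -/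
lemma isWeylVector_of_localWeyl (hV : ∀ z ∈ localWeylIdeal F C b n l ω, z • w = 0)
    (hω : IsLWeight F C b l a ω) :
    IsWeylVector C b l a w where
  rootVec_smul α f hα := by
    induction f using AddMonoidAlgebra.induction_linear with
    | zero => rw [map_zero]; exact zero_smul (Hyper F C (Fin n →₀ ℤ)) w
    | add _ _ h h' => rw [map_add, add_smul, h, h', add_zero]
    | single m c =>
      have h : hyperElt F C b m (rootVec C b α) • w = 0 :=
        hV _ (Submodule.subset_span (Or.inl (Or.inl (hyperElt_mem_augmentation hα m))))
      rw [cur_single, smul_assoc, h, smul_zero]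
  corootVec_smul α f := ⟨_, cur_corootVec_smul_of_localWeyl hV α f⟩
  coroot_pow_smul i j s := by
    have h := corootForm_aeval hω i j ((Polynomial.X - Polynomial.C (a j)) ^ (s + 1))
    rw [map_pow, map_sub, Polynomial.aeval_X, Polynomial.aeval_C] at h
    rw [cur_corootVec_smul_of_localWeyl hV, coordSub, h]
    simp
  weight_smul i := by
    rw [← cur_one, cur_corootVec_smul_of_localWeyl hV, corootForm_one hω]
  lowering_smul α m k hα hm hk := by
    have hk0 : (k.factorial : F) ≠ 0 := by exact_mod_cast k.factorial_ne_zero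
    have h := hV _
      (Submodule.subset_span (Or.inr ⟨α, m, k, hα, hm, hk, rfl⟩))
    rw [divPow_eq b, smul_assoc] at h
    exact (smul_eq_zero.mp h).resolve_left (inv_ne_zero hk0)

/-- If `V` is generated by a vector satisfying the relations of a local Weyl module, then it is
generated by this vector over the hyperalgebra of `𝔤[n]` already, and this vector satisfies the
shifted relations of the graded local Weyl module. -/
lemma exists_currentToLoop_smul_and_smul_eq_zero (hω : IsLWeight F C b l a ω)
    (hw : ∀ x : V, ∃ h : Hyper F C (Fin n →₀ ℤ), h • w = x)
    (hV : ∀ z ∈ localWeylIdeal F C b n l ω, z • w = 0) :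
    (∀ x : V, ∃ r, currentToLoop F C n r • w = x) ∧
      ∀ z ∈ gradedWeylIdeal F C b n l, currentToLoop F C n (shiftEquiv C b a z) • w = 0 := by
  have hW := isWeylVector_of_localWeyl hV hω
  refine ⟨fun x ↦ ?_, fun z hz ↦ hW.shiftToLoop_smul_eq_zero hz⟩
  obtain ⟨h, hh⟩ := hw x
  obtain ⟨r, hr⟩ := hW.exists_currentToLoop_smul h
  exact ⟨r, hr.symm.trans hh⟩

end LocalWeyl

end Multiloop

end

open Multiloop in
theorem proposition2p10 {𝔤 : Type*} [LieRing 𝔤] [LieAlgebra ℂ 𝔤] [FiniteDimensional ℂ 𝔤]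
    [LieAlgebra.IsSimple ℂ 𝔤] (𝔥 : LieSubalgebra ℂ 𝔤) [𝔥.IsCartanSubalgebra]
    (b : (LieAlgebra.IsKilling.rootSystem 𝔥).Base) (C : ChevalleyBasis 𝔥)
    (F : Type*) [Field F] [IsAlgClosed F] [CharZero F] (n : ℕ) (hn : 0 < n)
    (l : b.support → ℕ) (a : Fin n → F) (ha : a ≠ 0) :
    ∃ φ : Hyper F C (Fin n →₀ ℕ) ≃ₐ[F] Hyper F C (Fin n →₀ ℕ), IsShift F C b a φ ∧
      ∀ ω : SubHyper F C (Fin n →₀ ℤ) (cartan 𝔥 (Fin n →₀ ℤ)) →ₐ[F] F, IsLWeight F C b l a ω →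
        ∃ π : GradedWeyl F C b n l →ₗ[Hyper F C (Fin n →₀ ℕ)]
            Pullback (φ : Hyper F C (Fin n →₀ ℕ) →+* Hyper F C (Fin n →₀ ℕ))
              (Pullback (currentToLoop F C n : Hyper F C (Fin n →₀ ℕ) →+* Hyper F C (Fin n →₀ ℤ))
                (LocalWeyl F C b n l ω)),
          Function.Surjective π := by
  refine ⟨shiftEquiv C b a, isShift_shiftEquiv a, fun ω hω ↦ ?_⟩
  -- the scalars of `F` act on the module through the hyperalgebra
  have h := @exists_currentToLoop_smul_and_smul_eq_zero 𝔤 _ _ _ _ 𝔥 _ F _ _ C b n l a ω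
    (LocalWeyl F C b n l ω) _ (Module.compHom _ (algebraMap F (Hyper F C (Fin n →₀ ℤ)))) _
    (isScalarTower_compHom F (Hyper F C (Fin n →₀ ℤ)) _) (Submodule.Quotient.mk 1) hω
    (fun x ↦ ?_) fun z hz ↦ ?_
  · exact exists_surjective_pullback (shiftEquiv C b a).surjective h.1 h.2
  · obtain ⟨h, rfl⟩ := Submodule.Quotient.mk_surjective (localWeylIdeal F C b n l ω) x
    exact ⟨h, by rw [← Submodule.Quotient.mk_smul, smul_eq_mul, mul_one]⟩
  · rw [← Submodule.Quotient.mk_smul, smul_eq_mul, mul_one, Submodule.Quotient.mk_eq_zero]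
    exact hz
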